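/- Let $k$ be an algebraically closed field, let $n\ge 3$, and let $\Lambda=k[T_1,\dots,T_n]/(T_1,\dots,T_n)^2$. A projective variety over $k$ is a Zariski closed subset of some projective space $\mathbb P^N(k)$ (possibly reducible). For a finite-dimensional $\Lambda$-module $M$ and $i\ge 0$, the quiver Grassmannian $\mathbb G_i(M)$ is the set of $\Lambda$-submodules of $M$ of $k$-dimension $i$, regarded as a projective variety by means of the Plücker embedding $U\mapsto \bigwedge^i U\subseteq\bigwedge^i M$. A finite-dimensional $k$-algebra $A$ is called controlled wild if for every finite-dimensional $k$-algebra $B$ there are an exact faithful $k$-linear functor $F:\operatorname{mod} B\to\operatorname{mod} A$ between the categories of finite-dimensional modules and a full subcategory $\mathcal C$ of $\operatorname{mod} A$ such that for all $B$-modules $X,Y$, writing $\operatorname{Hom}(FX,\mathcal C,FY)$ for the set of maps which factor through a module in $\operatorname{add}\mathcal C$, we have $\operatorname{Hom}(FX,\mathcal C,FY)\subseteq\operatorname{rad}(FX,FY)$ and $\operatorname{Hom}(FX,FY)=F\operatorname{Hom}(X,Y)\oplus\operatorname{Hom}(FX,\mathcal C,FY)$; here $\operatorname{rad}$ is the ideal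 of $\operatorname{mod}A$ generated by the non-invertible maps between indecomposable modules. Then: (1) $\Lambda$ is a finite-dimensional local algebra with $(\operatorname{rad}\Lambda)^2=0$, and it is controlled wild. (2) Let $M$ be a finite-dimensional $\Lambda$-module and $i\ge 0$. If $i\le\dim M$, then $\mathbb G_i(M)$ is (non-empty and) connected. It is rationally connected in the sense that any two of its points are joined by a chain of rational curves in $\mathbb G_i(M)$, the length of the chain and the degrees of the curves being bounded independently of the two points. Moreover, if $i\le\dim\operatorname{soc}M$, then for every $U\in\mathbb G_i(M)$ with $U\not\subseteq\operatorname{soc}M$ there is a projective line in $\mathbb G_i(M)$ (a closed subset isomorphic to $\mathbb P^1$) which contains $U$ and some $U'\in\mathbb G_i(\operatorname{soc}M)$. Dually, if $i>\dim\operatorname{soc}M$, then for every $U\in\mathbb G_i(M)$ with $\operatorname{rad}M\not\subseteq U$ there is a projective line in $\mathbb G_i(M)$ which contains $U$ and some $U'\in\mathbb G_i(M)$ with $\operatorname{rad}M\subseteq U'$. (3) Not every projective variety is a quiver Grassmannian of a $\Lambda$-module: there is a projective variety, even an irreducible one, which is not isomorphic to $\mathbb G_i(M)$ for any finite-dimensional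 $\Lambda$-module $M$ and any $i$. -/

import Mathlib

open scoped LinearAlgebra.Projectivization
open CategoryTheory

universe u

/-! ## Projective algebraic sets and their morphisms (classical language) -/

section Projective

variable (k : Type*) [Field k]
variable {W : Type*} [AddCommGroup W] [Module k W]
variable {W' : Type*} [AddCommGroup W'] [Module k W']

/-- Homogeneous polynomial functions of degree `d` on a `k`-vector space `W`: homogeneous
polynomial expressions of degree `d` in linear forms on `W`. -/
def IsHomogeneousFun (d : ℕ) (f : W → k) : Prop :=
  ∃ p : MvPolynomial (Module.Dual k W) k, p.IsHomogeneous d ∧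
    ∀ w : W, f w = MvPolynomial.eval (fun φ : Module.Dual k W => φ w) p

/-- Homogeneous polynomial maps of degree `d` between vector spaces: all coordinates are
homogeneous polynomial functions of degree `d`. -/
def IsHomogeneousMap (d : ℕ) (F : W → W') : Prop :=
  ∀ φ : Module.Dual k W', IsHomogeneousFun k d (fun w => φ (F w))

variable (W) in
/-- The Zariski topology on the projective space `ℙ k W`, generated by the nonvanishing loci of
homogeneous polynomial functions. -/
instance zariskiTopology : TopologicalSpace (ℙ k W) :=
  TopologicalSpace.generateFrom
    {O | ∃ (d : ℕ) (f : W → k), IsHomogeneousFun k d f ∧ O = {x : ℙ k W | f x.rep ≠ 0}}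

variable {k}
variable {X Y : Type*}

/-- `X` and `Y` are regarded as subsets of projective spaces by means of the injections `ιX` and
`ιY`. A map `f : X → Y` is regular if, locally in the Zariski topology, it is given by a tuple of
homogeneous polynomials of the same degree without common zero. -/
def IsRegularMap (ιX : X → ℙ k W) (ιY : Y → ℙ k W') (f : X → Y) : Prop :=
  ∀ x : X, ∃ (O : Set (ℙ k W)) (d : ℕ) (F : W → W'),
    IsOpen O ∧ ιX x ∈ O ∧ IsHomogeneousMap k d F ∧
      ∀ y : X, ιX y ∈ O →
        ∃ h : F (ιX y).rep ≠ 0, ιY (f y) = Projectivization.mk k (F (ιX y).rep) h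

/-- A bijection which is regular in both directions, that is, an isomorphism of varieties. -/
def IsVarietyIso (ιX : X → ℙ k W) (ιY : Y → ℙ k W') (e : X ≃ Y) : Prop :=
  IsRegularMap ιX ιY e ∧ IsRegularMap ιY ιX e.symm

/-- `L` is a projective line in `X`: its image in projective space is closed, and it is isomorphic
as a variety to `ℙ¹`. -/
def IsProjectiveLineIn (ι : X → ℙ k W) (L : Set X) : Prop :=
  IsClosed (ι '' L) ∧
    ∃ e : ℙ k (Fin 2 → k) ≃ L, IsVarietyIso (fun p => p) (fun x : L => ι x) e

/-- `f : ℙ¹ → X` is a (possibly constant) morphism of degree at most `D`. Morphisms from `ℙ¹` to a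
projective space are given globally by homogeneous polynomials of the same degree without common
zero. -/
def IsRationalCurve (D : ℕ) (ι : X → ℙ k W) (f : ℙ k (Fin 2 → k) → X) : Prop :=
  ∃ d ≤ D, ∃ F : (Fin 2 → k) → W, IsHomogeneousMap k d F ∧
    ∀ p : ℙ k (Fin 2 → k),
      ∃ h : F p.rep ≠ 0, ι (f p) = Projectivization.mk k (F p.rep) h

/-- Rational connectedness of a possibly reducible and singular projective algebraic set: any two
points are joined by a chain of rational curves, the length of the chain and the degrees of the
curves being bounded independently of the two points. -/
def IsRationallyChainConnected (ι : X → ℙ k W) : Prop :=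
  ∃ D l : ℕ, ∀ x y : X, ∃ c : Fin (l + 1) → X, c 0 = x ∧ c (Fin.last l) = y ∧
    ∀ j : Fin l, ∃ f : ℙ k (Fin 2 → k) → X, IsRationalCurve D ι f ∧
      (∃ a, f a = c j.castSucc) ∧ (∃ b, f b = c j.succ)

end Projective

/-! ## Quiver Grassmannians -/

/-- The socle of a module: the sum of its simple submodules. -/
def moduleSocle (R : Type*) [Ring R] (M : Type*) [AddCommGroup M] [Module R M] : Submodule R M :=
  sSup {S : Submodule R M | IsSimpleModule R S}

section Grassmannian

variable (k : Type*) [Field k] (A : Type*) [Ring A] [Algebra k A]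
variable (M : Type*) [AddCommGroup M] [Module k M] [Module A M] [IsScalarTower k A M]

/-- The set of all `A`-submodules of `M` of `k`-dimension `i`. -/
structure QuiverGrassmannian [FiniteDimensional k M] (i : ℕ) where
  /-- the submodule -/
  toSubmodule : Submodule A M
  finrank_eq : Module.finrank k toSubmodule = i

namespace QuiverGrassmannian

variable {k A M} [FiniteDimensional k M] {i : ℕ}

theorem finrank_plucker (U : QuiverGrassmannian k A M i) :
    Module.finrank k (LinearMap.range
      (exteriorPower.map i (U.toSubmodule.restrictScalars k).subtype)) = 1 := by
  rw [LinearMap.finrank_range_of_inj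
    (exteriorPower.map_injective_field (Submodule.subtype_injective _)),
    exteriorPower.finrank_eq]
  have h : Module.finrank k (U.toSubmodule.restrictScalars k) = i := U.finrank_eq
  rw [h, Nat.choose_self]

/-- The Plücker embedding, sending `U` to the line `⋀ⁱ U` in `⋀ⁱ M`. -/
noncomputable def plucker (U : QuiverGrassmannian k A M i) : ℙ k (⋀[k]^i M) :=
  Projectivization.mk'' _ U.finrank_plucker

/-- The Zariski topology on the quiver Grassmannian. -/
noncomputable instance : TopologicalSpace (QuiverGrassmannian k A M i) :=
  TopologicalSpace.induced plucker (zariskiTopology k (⋀[k]^i M))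

end QuiverGrassmannian

end Grassmannian

/-! ## Controlled wild algebras -/

section ControlledWild

variable {R : Type u} [Ring R]

/-- Indecomposable modules. -/
def IsIndecomposableModule (X : FGModuleCat.{u} R) : Prop :=
  Nontrivial X ∧ ∀ p q : Submodule R X, IsCompl p q → p = ⊥ ∨ q = ⊥

/-- The radical of the category of finitely generated modules: the ideal generated by all
non-invertible maps between indecomposable modules. -/
def radHom (X Y : FGModuleCat.{u} R) : AddSubgroup (X ⟶ Y) :=
  AddSubgroup.closure
    {h | ∃ (A B : FGModuleCat.{u} R) (a : X ⟶ A) (g : A ⟶ B) (b : B ⟶ Y),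
      IsIndecomposableModule A ∧ IsIndecomposableModule B ∧ ¬ IsIso g ∧ h = a ≫ g ≫ b}

/-- `add C`, the closure of `C` under finite direct sums and direct summands: the direct summands
of the finite direct sums of objects of `C`. -/
def addClosure (C : ObjectProperty (FGModuleCat.{u} R)) : ObjectProperty (FGModuleCat.{u} R) :=
  fun X => ∃ (J : Type) (_ : Fintype J) (Z : J → FGModuleCat.{u} R), (∀ j, C (Z j)) ∧
    ∃ (s : X →ₗ[R] (∀ j, Z j)) (r : (∀ j, Z j) →ₗ[R] X), r ∘ₗ s = LinearMap.id

/-- `add C` is closed under binary direct sums. -/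
theorem addClosure_prod {C : ObjectProperty (FGModuleCat.{u} R)} {X Y : FGModuleCat.{u} R}
    (hX : addClosure C X) (hY : addClosure C Y) :
    addClosure C (FGModuleCat.of R (X × Y)) := by
  obtain ⟨I, _, Z, hZ, s, r, hrs⟩ := hX
  obtain ⟨J, _, Z', hZ', s', r', hrs'⟩ := hY
  let T : I ⊕ J → FGModuleCat.{u} R := Sum.elim Z Z'
  let e : (∀ t, T t) ≃ₗ[R] ((∀ j, Z j) × (∀ j, Z' j)) :=
    LinearEquiv.sumPiEquivProdPi R I J (fun t => (T t : Type u))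
  refine ⟨I ⊕ J, inferInstance, T, ?_,
    e.symm.toLinearMap ∘ₗ (s.prodMap s'), (r.prodMap r') ∘ₗ e.toLinearMap, ?_⟩
  · rintro (a | b)
    · exact hZ a
    · exact hZ' b
  · apply LinearMap.ext
    rintro ⟨x, y⟩
    have h1 := LinearMap.congr_fun hrs x
    have h2 := LinearMap.congr_fun hrs' y
    simp only [LinearMap.comp_apply, LinearMap.id_apply] at h1 h2
    simp [h1, h2]

/-- `Hom(X, C, Y)`: the subgroup of `Hom(X, Y)` of all maps which factor through a module in
`add C`. -/
def homThrough (C : ObjectProperty (FGModuleCat.{u} R)) (X Y : FGModuleCat.{u} R) :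
    AddSubgroup (X ⟶ Y) where
  carrier := {h | ∃ Z : FGModuleCat.{u} R, addClosure C Z ∧
    ∃ (a : X ⟶ Z) (b : Z ⟶ Y), h = a ≫ b}
  zero_mem' := by
    refine ⟨FGModuleCat.of R PUnit, ⟨Empty, inferInstance, Empty.elim, fun j => j.elim, 0, 0, ?_⟩, 0, 0, by simp⟩
    exact LinearMap.ext fun x => Subsingleton.elim (α := PUnit) _ _
  add_mem' := by
    rintro _ _ ⟨Z, hZ, a, b, rfl⟩ ⟨Z', hZ', a', b', rfl⟩
    refine ⟨_, addClosure_prod hZ hZ',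
      FGModuleCat.ofHom (LinearMap.prod a.hom.hom a'.hom.hom),
      FGModuleCat.ofHom (LinearMap.coprod b.hom.hom b'.hom.hom), ?_⟩
    ext x
    rfl
  neg_mem' := by
    rintro _ ⟨Z, hZ, a, b, rfl⟩
    exact ⟨Z, hZ, a, -b, by simp⟩

/-- Exactness of a functor between module categories: exact sequences `X → Y → Z` are sent to
exact sequences. -/
def IsExactFunctor {S : Type u} [Ring S] (F : FGModuleCat.{u} S ⥤ FGModuleCat.{u} R) : Prop :=
  ∀ ⦃X Y Z : FGModuleCat.{u} S⦄ (f : X ⟶ Y) (g : Y ⟶ Z),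
    Function.Exact f.hom.hom g.hom.hom → Function.Exact (F.map f).hom.hom (F.map g).hom.hom

/-- Controlled wild algebras: for every finite-dimensional `k`-algebra `B` there are an exact
embedding (that is, faithful) `k`-linear functor `F : mod B ⥤ mod A` and a control class `C`, such
that `Hom(FX, C, FY)` lies in the radical and `Hom(FX, FY) = F Hom(X, Y) ⊕ Hom(FX, C, FY)`.
These conditions force `F` to reflect isomorphism of objects. -/
def IsControlledWild (k : Type u) [Field k] (A : Type u) [Ring A] [Algebra k A] : Prop :=
  ∀ (B : Type u) [Ring B] [Algebra k B] [FiniteDimensional k B],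
    ∃ (F : FGModuleCat.{u} B ⥤ FGModuleCat.{u} A) (_ : F.Additive),
      F.Linear k ∧ F.Faithful ∧ IsExactFunctor F ∧
        ∃ C : ObjectProperty (FGModuleCat.{u} A), ∀ X Y : FGModuleCat.{u} B,
          homThrough C (F.obj X) (F.obj Y) ≤ radHom (F.obj X) (F.obj Y) ∧
          IsCompl (F.mapAddHom : (X ⟶ Y) →+ (F.obj X ⟶ F.obj Y)).range
            (homThrough C (F.obj X) (F.obj Y))

end ControlledWild

/-- The algebra `k[T₁, …, Tₙ] / (T₁, …, Tₙ)²`. -/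
abbrev RadSquareZeroAlgebra (k : Type u) [Field k] (n : ℕ) : Type u :=
  MvPolynomial (Fin n) k ⧸ (Ideal.span (Set.range (MvPolynomial.X (R := k) (σ := Fin n)))) ^ 2

/-! Write `Λ` for the algebra and `T_j` for its generators. Every product `T_i T_j` is zero, so `rad
M ⊆ soc M` for every module `M`. Moreover every subspace of `soc M`, and every subspace containing
`rad M`, is a submodule.

Connectedness. Let `U ≠ U'` be points of a quiver Grassmannian such that the radical maps `U + U'`
into `U ∩ U'`. Complete a basis of `U ∩ U'` to bases `x` of `U` and `y` of `U'`. For each `[a : b]`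
the vectors `a x_j + b y_j`, together with the basis of `U ∩ U'`, span a submodule. In Plücker
coordinates this pencil is a rational normal curve, hence a projective line
(`exists_line_of_pencil`, `QuiverGrassmannian.exists_line`). If `i ≤ dim soc M`, then `U` is joined
in this way to a subspace of the socle containing `U ∩ soc M`; otherwise it is joined to a subspace
of `U + rad M` containing `rad M`. Any two points of the special kind are again joined by such a
line, so three curves of degree at most `i` always suffice.

Not every variety occurs. By the polynomial case of Fermat's last theorem, a Fermat curve of degree
`m ≥ 3` with `m ≠ 0` in `k` admits only constant maps from `ℙ¹`, so a rationally chain connected set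
maps to it constantly. The curve is irreducible by Eisenstein's criterion and has more than one
point.

Wildness. For a `B`-module `X` put two copies of `X ^ (m + 1)` side by side and let three generators
act from the first copy to the second: by the identity, by a diagonal matrix with distinct scalars,
and by a matrix containing a row of ones and a spanning family of `B`. The first identifies the
copies, the second forces a commuting map to be diagonal, and the third makes its entries equal and
`B`-linear. What remains are the maps into the second copy, which are those factoring through
semisimple modules. -/

/-! ### Homogeneous polynomial maps and the Zariski topology. -/

section HomogeneousFunctions

variable {k : Type*} [Field k]
variable {W : Type*} [AddCommGroup W] [Module k W]
variable {W' : Type*} [AddCommGroup W'] [Module k W']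
variable {W'' : Type*} [AddCommGroup W''] [Module k W'']

namespace IsHomogeneousFun

theorem linear (φ : Module.Dual k W) : IsHomogeneousFun k 1 (fun w => φ w) :=
  ⟨MvPolynomial.X φ, MvPolynomial.isHomogeneous_X _ _, fun w => by simp⟩

theorem const (c : k) : IsHomogeneousFun k 0 (fun _ : W => c) :=
  ⟨MvPolynomial.C c, MvPolynomial.isHomogeneous_C _ _, fun w => by simp⟩

theorem zero (d : ℕ) : IsHomogeneousFun k d (fun _ : W => (0 : k)) :=
  ⟨0, MvPolynomial.isHomogeneous_zero _ _ _, fun w => by simp⟩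

theorem mul {d e : ℕ} {f g : W → k} (hf : IsHomogeneousFun k d f) (hg : IsHomogeneousFun k e g) :
    IsHomogeneousFun k (d + e) (fun w => f w * g w) := by
  obtain ⟨p, hp, hpf⟩ := hf
  obtain ⟨q, hq, hqg⟩ := hg
  exact ⟨p * q, hp.mul hq, fun w => by simp [hpf, hqg]⟩

theorem add {d : ℕ} {f g : W → k} (hf : IsHomogeneousFun k d f) (hg : IsHomogeneousFun k d g) :
    IsHomogeneousFun k d (fun w => f w + g w) := by
  obtain ⟨p, hp, hpf⟩ := hf
  obtain ⟨q, hq, hqg⟩ := hg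
  exact ⟨p + q, hp.add hq, fun w => by simp [hpf, hqg]⟩

theorem sub {d : ℕ} {f g : W → k} (hf : IsHomogeneousFun k d f) (hg : IsHomogeneousFun k d g) :
    IsHomogeneousFun k d (fun w => f w - g w) := by
  obtain ⟨p, hp, hpf⟩ := hf
  obtain ⟨q, hq, hqg⟩ := hg
  exact ⟨p - q, hp.sub hq, fun w => by simp [hpf, hqg]⟩

theorem pow {d : ℕ} {f : W → k} (hf : IsHomogeneousFun k d f) (e : ℕ) :
    IsHomogeneousFun k (d * e) (fun w => f w ^ e) := by
  obtain ⟨p, hp, hpf⟩ := hf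
  exact ⟨p ^ e, hp.pow e, fun w => by simp [hpf]⟩

theorem sum {ι : Type*} {d : ℕ} (s : Finset ι) {f : ι → W → k}
    (hf : ∀ j ∈ s, IsHomogeneousFun k d (f j)) :
    IsHomogeneousFun k d (fun w => ∑ j ∈ s, f j w) := by
  classical
  induction s using Finset.induction_on with
  | empty => simpa using zero d
  | insert a s ha ih =>
    simp only [Finset.sum_insert ha]
    exact (hf a (by simp)).add (ih fun j hj => hf j (by simp [hj]))

theorem smul {d : ℕ} {f : W → k} (hf : IsHomogeneousFun k d f) (c : k) (w : W) :
    f (c • w) = c ^ d * f w := by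
  obtain ⟨p, hp, hpf⟩ := hf
  rw [hpf, hpf, MvPolynomial.eval_eq, MvPolynomial.eval_eq, Finset.mul_sum]
  refine Finset.sum_congr rfl fun s hs => ?_
  have hd : ∑ i ∈ s.support, s i = d := by
    have := hp (MvPolynomial.mem_support_iff.1 hs)
    rw [← this, Finsupp.weight_apply]
    simp [Finsupp.sum]
  simp only [map_smul, smul_eq_mul, mul_pow, Finset.prod_mul_distrib, Finset.prod_pow_eq_pow_sum,
    hd]
  ring

/-- Substitution: each variable `φ`, a linear form on `W'`, is replaced by a polynomial expressing
`φ ∘ F`. -/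
theorem comp {d e : ℕ} {f : W' → k} {F : W → W'} (hf : IsHomogeneousFun k e f)
    (hF : IsHomogeneousMap k d F) : IsHomogeneousFun k (d * e) (fun w => f (F w)) := by
  obtain ⟨p, hp, hpf⟩ := hf
  choose q hq hqF using hF
  refine ⟨MvPolynomial.aeval q p, hp.aeval _ hq, fun w => ?_⟩
  have h : (MvPolynomial.eval fun φ : Module.Dual k W => φ w).comp
      (MvPolynomial.aeval (R := k) q).toRingHom =
      MvPolynomial.eval (fun φ : Module.Dual k W' => φ (F w)) := by
    refine MvPolynomial.ringHom_ext (fun r => by simp) fun φ => by simp [hqF]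
  exact (hpf (F w)).trans (DFunLike.congr_fun h p).symm

/-- Along an affine line, a homogeneous polynomial function is a polynomial function. -/
theorem exists_polynomial {d : ℕ} {f : W → k} (hf : IsHomogeneousFun k d f) (w v : W) :
    ∃ P : Polynomial k, ∀ t : k, P.eval t = f (w + t • v) := by
  obtain ⟨p, -, hpf⟩ := hf
  refine ⟨MvPolynomial.aeval (fun φ : Module.Dual k W =>
    Polynomial.C (φ w) + Polynomial.X * Polynomial.C (φ v)) p, fun t => ?_⟩
  have h : (Polynomial.evalRingHom t).comp (MvPolynomial.aeval (R := k)
      (fun φ : Module.Dual k W =>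
        Polynomial.C (φ w) + Polynomial.X * Polynomial.C (φ v))).toRingHom =
      MvPolynomial.eval (fun φ : Module.Dual k W => φ (w + t • v)) := by
    refine MvPolynomial.ringHom_ext (fun r => by simp) fun φ => by
      simp [mul_comm t]
  rw [hpf, ← h]
  rfl

/-- The topology is defined through the chosen representatives `rep`. This lemma allows any other
representative to be used, since rescaling multiplies the value by a power of a unit. -/
theorem ne_zero_iff_of_mk_eq {d : ℕ} {f : W → k} (hf : IsHomogeneousFun k d f) {w : W}
    (hw : w ≠ 0) : f (Projectivization.mk k w hw).rep ≠ 0 ↔ f w ≠ 0 := by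
  obtain ⟨a, ha⟩ := Projectivization.exists_smul_eq_mk_rep k w hw
  rw [← ha, Units.smul_def, hf.smul]
  simp

theorem isOpen {d : ℕ} {f : W → k} (hf : IsHomogeneousFun k d f) :
    IsOpen {x : ℙ k W | f x.rep ≠ 0} :=
  TopologicalSpace.isOpen_generateFrom_of_mem ⟨d, f, hf, rfl⟩

theorem isClosed {d : ℕ} {f : W → k} (hf : IsHomogeneousFun k d f) :
    IsClosed {x : ℙ k W | f x.rep = 0} :=
  ⟨by simpa [Set.compl_ofPred] using hf.isOpen⟩

end IsHomogeneousFun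

namespace IsHomogeneousMap

theorem smul {d : ℕ} {F : W → W'} (hF : IsHomogeneousMap k d F) (c : k) (w : W) :
    F (c • w) = c ^ d • F w := by
  rw [← sub_eq_zero]
  refine (Module.forall_dual_apply_eq_zero_iff k _).1 fun φ => ?_
  rw [map_sub, (hF φ).smul, map_smul, smul_eq_mul, sub_self]

theorem comp {d e : ℕ} {G : W' → W''} {F : W → W'} (hG : IsHomogeneousMap k e G)
    (hF : IsHomogeneousMap k d F) : IsHomogeneousMap k (d * e) (fun w => G (F w)) :=
  fun φ => (hG φ).comp hF

theorem const (v : W') : IsHomogeneousMap k 0 (fun _ : W => v) :=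
  fun φ => IsHomogeneousFun.const (φ v)

theorem mk_congr {d : ℕ} {F : W → W'} (hF : IsHomogeneousMap k d F) {w : W} (hw : w ≠ 0)
    {v : W} {hv : v ≠ 0} (h : Projectivization.mk k w hw = Projectivization.mk k v hv)
    (hFw : F w ≠ 0) :
    ∃ hFv : F v ≠ 0, Projectivization.mk k (F w) hFw = Projectivization.mk k (F v) hFv := by
  obtain ⟨a, rfl⟩ := (Projectivization.mk_eq_mk_iff k _ _ hw hv).1 h
  have e : F (a • v) = (a ^ d) • F v := by rw [Units.smul_def, hF.smul, Units.smul_def]; simp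
  have hFv : F v ≠ 0 := fun h0 => hFw (by rw [e, h0, smul_zero])
  refine ⟨hFv, (Projectivization.mk_eq_mk_iff k _ _ _ _).2 ⟨a ^ d, e.symm⟩⟩

end IsHomogeneousMap

/-- Basic open sets form a neighbourhood basis in the Zariski topology. -/
theorem exists_basic_open {O : Set (ℙ k W)} (hO : IsOpen O) {x : ℙ k W} (hx : x ∈ O) :
    ∃ (d : ℕ) (f : W → k), IsHomogeneousFun k d f ∧ f x.rep ≠ 0 ∧
      {y : ℙ k W | f y.rep ≠ 0} ⊆ O := by
  induction hO with
  | basic s hs =>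
    obtain ⟨d, f, hf, rfl⟩ := hs
    exact ⟨d, f, hf, hx, subset_rfl⟩
  | univ => exact ⟨0, _, IsHomogeneousFun.const 1, one_ne_zero, Set.subset_univ _⟩
  | inter s t _ _ hs ht =>
    obtain ⟨d, f, hf, hfx, hfs⟩ := hs hx.1
    obtain ⟨e, g, hg, hgx, hgt⟩ := ht hx.2
    exact ⟨d + e, _, hf.mul hg, mul_ne_zero hfx hgx, fun y hy =>
      ⟨hfs (left_ne_zero_of_mul hy), hgt (right_ne_zero_of_mul hy)⟩⟩
  | sUnion S _ hS =>
    obtain ⟨s, hs, hxs⟩ := hx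
    obtain ⟨d, f, hf, hfx, hfs⟩ := hS s hs hxs
    exact ⟨d, f, hf, hfx, hfs.trans (Set.subset_sUnion_of_mem hs)⟩

/-- Representatives of distinct points are linearly independent, and the coefficients `1 - t` and
`t` are never both zero. So the affine line through the representatives avoids the origin. -/
theorem Projectivization.rep_add_smul_sub_ne_zero {x y : ℙ k W} (hxy : x ≠ y) (t : k) :
    x.rep + t • (y.rep - x.rep) ≠ 0 := by
  intro h0
  have hli := (Projectivization.linearIndependent_pair_iff_ne (K := k)).2 hxy
  have h1 : (1 - t) • x.rep + t • y.rep = 0 := by rw [← h0]; module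
  have := LinearIndependent.pair_iff.1 hli _ _ h1
  have h2 : (1 : k) = 0 := by linear_combination this.1 + this.2
  exact one_ne_zero h2

theorem Projectivization.mk_eq_mk_of_cross {ι : Type*} {v w : ι → k} (hv : v ≠ 0) (hw : w ≠ 0)
    (h : ∀ i j, v i * w j = w i * v j) :
    Projectivization.mk k v hv = Projectivization.mk k w hw := by
  obtain ⟨j, hj⟩ := Function.ne_iff.1 hw
  rw [Projectivization.mk_eq_mk_iff']
  refine ⟨v j / w j, funext fun i => ?_⟩
  have hj' : w j ≠ 0 := hj
  simp only [Pi.smul_apply, smul_eq_mul]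
  field_simp
  linear_combination -h i j

/-- Two homogeneous functions which do not vanish identically have a common point of
nonvanishing on the line through two given points. -/
theorem exists_ne_zero_line [Infinite k] {d e : ℕ} {f g : W → k} (hf : IsHomogeneousFun k d f)
    (hg : IsHomogeneousFun k e g) {x y : ℙ k W} (hx : f x.rep ≠ 0) (hy : g y.rep ≠ 0) :
    ∃ z : ℙ k W, f z.rep ≠ 0 ∧ g z.rep ≠ 0 := by
  by_cases hxy : x = y
  · exact ⟨x, hx, hxy ▸ hy⟩
  obtain ⟨P, hP⟩ := hf.exists_polynomial x.rep (y.rep - x.rep)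
  obtain ⟨Q, hQ⟩ := hg.exists_polynomial x.rep (y.rep - x.rep)
  have hP0 : P ≠ 0 := by
    rintro rfl
    exact hx (by simpa using (hP 0).symm)
  have hQ0 : Q ≠ 0 := by
    rintro rfl
    exact hy (by simpa using (hQ 1).symm)
  -- A nonzero polynomial has only finitely many roots, while `k` is infinite.
  obtain ⟨t, ht⟩ := Polynomial.exists_eval_ne_zero_of_natDegree_lt_card (P * Q)
    (mul_ne_zero hP0 hQ0) (lt_of_lt_of_le (Cardinal.natCast_lt_aleph0) (Cardinal.aleph0_le_mk k))
  rw [Polynomial.eval_mul, hP, hQ] at ht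
  have hz := Projectivization.rep_add_smul_sub_ne_zero hxy t
  exact ⟨Projectivization.mk k _ hz, (hf.ne_zero_iff_of_mk_eq hz).2 (left_ne_zero_of_mul ht),
    (hg.ne_zero_iff_of_mk_eq hz).2 (right_ne_zero_of_mul ht)⟩

/-- Irreducibility of projective space. It serves twice: for connectedness, and for gluing locally
constant maps on `ℙ¹`. -/
theorem projectivization_inter_nonempty [Infinite k] {O O' : Set (ℙ k W)} (hO : IsOpen O)
    (hO' : IsOpen O') (hne : O.Nonempty) (hne' : O'.Nonempty) : (O ∩ O').Nonempty := by
  obtain ⟨x, hx⟩ := hne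
  obtain ⟨y, hy⟩ := hne'
  obtain ⟨d, f, hf, hfx, hfO⟩ := exists_basic_open hO hx
  obtain ⟨e, g, hg, hgy, hgO⟩ := exists_basic_open hO' hy
  obtain ⟨z, hz, hz'⟩ := exists_ne_zero_line hf hg hfx hgy
  exact ⟨z, hfO hz, hgO hz'⟩

theorem projectivization_preconnectedSpace [Infinite k] : PreconnectedSpace (ℙ k W) :=
  ⟨IsPreirreducible.isPreconnected fun O O' hO hO' h h' => by
    simpa using projectivization_inter_nonempty hO hO' (by simpa using h) (by simpa using h')⟩

variable {X : Type*}

/-- The preimage of the basic open set `g ≠ 0` is the basic open set `g ∘ F ≠ 0`. -/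
theorem IsRationalCurve.continuous {D : ℕ} {ι : X → ℙ k W} {f : ℙ k (Fin 2 → k) → X}
    (hf : IsRationalCurve D ι f) : Continuous (fun p => ι (f p)) := by
  obtain ⟨d, -, F, hF, h⟩ := hf
  refine continuous_generateFrom_iff.2 ?_
  rintro _ ⟨e, g, hg, rfl⟩
  have : (fun p => ι (f p)) ⁻¹' {x | g x.rep ≠ 0} = {p | g (F p.rep) ≠ 0} := by
    ext p
    obtain ⟨hp, hp'⟩ := h p
    simp only [Set.mem_preimage, Set.mem_ofPred_eq, hp']
    exact hg.ne_zero_iff_of_mk_eq hp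
  rw [this]
  exact (hg.comp hF).isOpen

theorem isRationalCurve_const (D : ℕ) (ι : X → ℙ k W) (x : X) :
    IsRationalCurve D ι (fun _ => x) :=
  ⟨0, Nat.zero_le _, fun _ => (ι x).rep, IsHomogeneousMap.const _, fun _ =>
    ⟨(ι x).rep_nonzero, (Projectivization.mk_rep _).symm⟩⟩

theorem IsRationalCurve.mono {D D' : ℕ} (h : D ≤ D') {ι : X → ℙ k W} {f : ℙ k (Fin 2 → k) → X}
    (hf : IsRationalCurve D ι f) : IsRationalCurve D' ι f := by
  obtain ⟨d, hd, F⟩ := hf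
  exact ⟨d, hd.trans h, F⟩

/-- Rationally chain connected projective algebraic sets are preconnected. -/
theorem IsRationallyChainConnected.preconnectedSpace [Infinite k] {ι : X → ℙ k W}
    (h : IsRationallyChainConnected ι) :
    @PreconnectedSpace X (TopologicalSpace.induced ι inferInstance) := by
  let : TopologicalSpace X := TopologicalSpace.induced ι inferInstance
  obtain ⟨D, l, hc⟩ := h
  refine ⟨isPreconnected_of_forall_pair fun x _ y _ => ?_⟩
  obtain ⟨c, rfl, rfl, hj⟩ := hc x y
  have : PreconnectedSpace (ℙ k (Fin 2 → k)) := projectivization_preconnectedSpace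
  have key : ∀ j : Fin (l + 1), c j ∈ connectedComponent (c 0) := by
    intro j
    induction j using Fin.induction with
    | zero => exact mem_connectedComponent
    | succ j ih =>
      obtain ⟨f, hf, ⟨a, ha⟩, ⟨b, hb⟩⟩ := hj j
      have hcont : Continuous f := continuous_induced_rng.2 hf.continuous
      have := (isPreconnected_range hcont).subset_connectedComponent
        (show c j.castSucc ∈ Set.range f from ⟨a, ha⟩)
      rw [connectedComponent_eq ih]
      exact this ⟨b, hb⟩
  exact ⟨connectedComponent (c 0), Set.subset_univ _, mem_connectedComponent,
    key _, isPreconnected_connectedComponent⟩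

end HomogeneousFunctions

/-! ### Rational normal curves. -/

section RationalNormalCurve

variable {k : Type*} [Field k] {E : Type*} [AddCommGroup E] [Module k E]

/-- The parametrization `(a, b) ↦ ∑ aᶜ b^(q-c) e_c` of a rational normal curve of degree `q`. -/
def rationalNormalCurve (q : ℕ) (e : ℕ → E) (v : Fin 2 → k) : E :=
  ∑ c ∈ Finset.range (q + 1), (v 0 ^ c * v 1 ^ (q - c)) • e c

variable {q : ℕ} {e : ℕ → E}

theorem isHomogeneousMap_rationalNormalCurve (q : ℕ) (e : ℕ → E) :
    IsHomogeneousMap k q (rationalNormalCurve (k := k) q e) := by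
  intro φ
  simp only [rationalNormalCurve, map_sum, map_smul, smul_eq_mul]
  refine IsHomogeneousFun.sum _ fun c hc => ?_
  have h0 := (IsHomogeneousFun.linear (LinearMap.proj (R := k) (φ := fun _ : Fin 2 => k) 0)).pow c
  have h1 := (IsHomogeneousFun.linear
    (LinearMap.proj (R := k) (φ := fun _ : Fin 2 => k) 1)).pow (q - c)
  have h := (h0.mul h1).mul (IsHomogeneousFun.const (φ (e c)))
  have hd : 1 * c + 1 * (q - c) + 0 = q := by
    have := Finset.mem_range.1 hc
    omega
  rw [hd] at h
  exact h

variable {θ : ℕ → Module.Dual k E}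

/-- The hypothesis `hθ` makes `θ 0, …, θ q` coordinates on the span of `e 0, …, e q`; in these
coordinates the curve is the list of all monomials of degree `q`. -/
theorem dual_rationalNormalCurve
    (hθ : ∀ a ≤ q, ∀ b ≤ q, θ a (e b) = if a = b then 1 else 0) {a : ℕ} (ha : a ≤ q)
    (v : Fin 2 → k) : θ a (rationalNormalCurve q e v) = v 0 ^ a * v 1 ^ (q - a) := by
  simp only [rationalNormalCurve, map_sum, map_smul, smul_eq_mul]
  rw [Finset.sum_eq_single a]
  · rw [hθ a ha a ha]; simp
  · intro b hb hba
    rw [hθ a ha b (by have := Finset.mem_range.1 hb; omega), if_neg (Ne.symm hba), mul_zero]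
  · intro h
    exact absurd (Finset.mem_range.2 (by omega)) h

theorem rationalNormalCurve_ne_zero
    (hθ : ∀ a ≤ q, ∀ b ≤ q, θ a (e b) = if a = b then 1 else 0) {v : Fin 2 → k} (hv : v ≠ 0) :
    rationalNormalCurve q e v ≠ 0 := by
  intro h
  have h0 := dual_rationalNormalCurve hθ (Nat.zero_le q) v
  have hq := dual_rationalNormalCurve hθ le_rfl v
  rw [h, map_zero] at h0 hq
  apply hv
  have h0' : v 1 = 0 := by
    rw [pow_zero, one_mul, Nat.sub_zero] at h0
    exact eq_zero_of_pow_eq_zero h0.symm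
  have hq' : v 0 = 0 := by
    rw [Nat.sub_self, pow_zero, mul_one] at hq
    exact eq_zero_of_pow_eq_zero hq.symm
  ext j
  fin_cases j
  · exact hq'
  · exact h0'

theorem linear_relations_of_rationalNormalCurve
    (hθ : ∀ a ≤ q, ∀ b ≤ q, θ a (e b) = if a = b then 1 else 0) (v : Fin 2 → k) :
    rationalNormalCurve q e v =
      ∑ c ∈ Finset.range (q + 1), θ c (rationalNormalCurve q e v) • e c := by
  conv_lhs => rw [rationalNormalCurve]
  refine Finset.sum_congr rfl fun c hc => ?_
  rw [dual_rationalNormalCurve hθ (by have := Finset.mem_range.1 hc; omega)]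

/-- The linear and quadratic equations of a rational normal curve. -/
theorem exists_rationalNormalCurve_eq (hq : 0 < q) {w : E} (hw : w ≠ 0)
    (hlin : w = ∑ c ∈ Finset.range (q + 1), θ c w • e c)
    (hquad : ∀ a < q, ∀ b < q, θ a w * θ (b + 1) w = θ (a + 1) w * θ b w) :
    ∃ v : Fin 2 → k, v ≠ 0 ∧ ∃ r : k, r ≠ 0 ∧ w = r • rationalNormalCurve q e v := by
  obtain ⟨q, rfl⟩ : ∃ m, q = m + 1 := ⟨q - 1, by omega⟩
  by_cases h : θ (q + 1) w = 0
  -- The last coordinate vanishes, so the point should be the image of `[0 : 1]`. The equation `x_c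
  -- x_(c+2) = x_(c+1) ^ 2` propagates the vanishing downwards to every coordinate of index at least
  -- `1`.
  · have hz : ∀ j ≤ q, θ (q + 1 - j) w = 0 := by
      intro j
      induction j with
      | zero => intro _; exact h
      | succ j ih =>
        intro hj
        obtain ⟨c, hc⟩ : ∃ c, q = c + j + 1 := ⟨q - j - 1, by omega⟩
        have e1 : q + 1 - (j + 1) = c + 1 := by omega
        have e2 : q + 1 - j = c + 1 + 1 := by omega
        have := hquad c (by omega) (c + 1) (by omega)
        rw [← e2, ih (by omega), mul_zero] at this
        rw [e1]
        exact mul_self_eq_zero.1 this.symm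
    have hz' : ∀ c, c ∈ Finset.range (q + 1 + 1) → c ≠ 0 → θ c w = 0 := by
      intro c hc hc0
      have := Finset.mem_range.1 hc
      have h1 := hz (q + 1 - c) (by omega)
      rwa [Nat.sub_sub_self (by omega)] at h1
    have hw0 : w = θ 0 w • e 0 := by
      conv_lhs => rw [hlin]
      rw [Finset.sum_eq_single 0]
      · intro c hc hc0
        rw [hz' c hc hc0, zero_smul]
      · intro h0
        exact absurd (Finset.mem_range.2 (by omega)) h0
    refine ⟨![0, 1], fun h0 => one_ne_zero (congrFun h0 1), θ 0 w, fun h0 => hw ?_, ?_⟩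
    · rw [hw0, h0, zero_smul]
    · conv_lhs => rw [hw0]
      congr 1
      rw [rationalNormalCurve, Finset.sum_eq_single 0]
      · simp
      · intro c hc hc0
        simp [hc0]
      · intro h0
        exact absurd (Finset.mem_range.2 (by omega)) h0
  -- The quadrics now say that consecutive coordinates have the constant ratio `t`, so the
  -- coordinates form a geometric progression and the point is the image of `[1 : t]`.
  · set t := θ q w / θ (q + 1) w with ht
    have hstep : ∀ a < q + 1, θ a w = t * θ (a + 1) w := by
      intro a ha
      have := hquad a ha q (by omega)
      rw [ht]
      field_simp
      linear_combination this
    have hpow : ∀ j ≤ q + 1, θ (q + 1 - j) w = t ^ j * θ (q + 1) w := by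
      intro j
      induction j with
      | zero => simp
      | succ j ih =>
        intro hj
        rw [hstep _ (by omega), show q + 1 - (j + 1) + 1 = q + 1 - j by omega, ih (by omega)]
        ring
    refine ⟨![1, t], fun h0 => one_ne_zero (congrFun h0 0), θ (q + 1) w, h, ?_⟩
    conv_lhs => rw [hlin]
    rw [rationalNormalCurve, Finset.smul_sum]
    refine Finset.sum_congr rfl fun c hc => ?_
    have hc' := Finset.mem_range.1 hc
    have := hpow (q + 1 - c) (by omega)
    rw [Nat.sub_sub_self (by omega)] at this
    rw [this, smul_smul]
    simp [mul_comm]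

variable {X : Type*} {ι : X → ℙ k E} {f : ℙ k (Fin 2 → k) → X}

theorem mk_rationalNormalCurve_injective (hq : 0 < q)
    (hθ : ∀ a ≤ q, ∀ b ≤ q, θ a (e b) = if a = b then 1 else 0) {v w : Fin 2 → k} (hv : v ≠ 0)
    (hw : w ≠ 0) {r : k} (h : rationalNormalCurve q e v = r • rationalNormalCurve q e w) :
    Projectivization.mk k v hv = Projectivization.mk k w hw := by
  obtain ⟨q, rfl⟩ : ∃ m, q = m + 1 := ⟨q - 1, by omega⟩
  have hr : r ≠ 0 := by
    rintro rfl
    rw [zero_smul] at h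
    exact rationalNormalCurve_ne_zero hθ hv h
  have key : ∀ a ≤ q + 1, v 0 ^ a * v 1 ^ (q + 1 - a) = r * (w 0 ^ a * w 1 ^ (q + 1 - a)) := by
    intro a ha
    rw [← dual_rationalNormalCurve hθ ha, ← dual_rationalNormalCurve hθ ha, h, map_smul,
      smul_eq_mul]
  -- The two top coordinates `v 0 ^ q * v 1` and `v 0 ^ (q + 1)` determine the ratio `v 1 / v 0`,
  -- unless `v 0 = 0`.
  have hcross : v 0 * w 1 = v 1 * w 0 := by
    have k0 := key 0 (by omega)
    have k1 := key 1 (by omega)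
    have kq := key q (by omega)
    have kq' := key (q + 1) le_rfl
    simp only [pow_zero, one_mul, Nat.sub_zero, pow_one, Nat.add_sub_cancel, Nat.sub_self,
      Nat.add_sub_cancel_left, mul_one] at k0 k1 kq kq'
    by_cases hv0 : v 0 = 0
    · have : w 0 = 0 := by
        rw [hv0, zero_pow (by omega)] at kq'
        have := (mul_eq_zero.1 kq'.symm).resolve_left hr
        exact pow_eq_zero_iff (by omega) |>.1 this
      rw [hv0, this]; ring
    · have hne : v 0 ^ q ≠ 0 := pow_ne_zero _ hv0
      have hw0 : w 0 ^ q ≠ 0 := by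
        intro h0
        rw [pow_succ, pow_succ, h0] at kq'
        simp [hv0] at kq'
      apply mul_left_cancel₀ (mul_ne_zero hne (mul_ne_zero hr hw0))
      linear_combination (r * w 0 ^ q * w 1) * kq' - (r * w 0 ^ q * w 0) * kq
  refine Projectivization.mk_eq_mk_of_cross hv hw fun i j => ?_
  fin_cases i <;> fin_cases j <;> simp only [Fin.zero_eta, Fin.mk_one]
  · ring
  · linear_combination hcross
  · linear_combination -hcross
  · ring

theorem isRationalCurve_rationalNormalCurve
    (hne : ∀ v : Fin 2 → k, v ≠ 0 → rationalNormalCurve q e v ≠ 0)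
    (hf : ∀ p, ι (f p) = Projectivization.mk k _ (hne p.rep p.rep_nonzero)) :
    IsRationalCurve q ι f :=
  ⟨q, le_rfl, _, isHomogeneousMap_rationalNormalCurve q e, fun p => ⟨_, hf p⟩⟩

/-- The curve is cut out by linear equations, placing the point in the span of `e 0, …, e q`, and by
the `2 × 2` minors of the matrix with rows `x_0, …, x_(q-1)` and `x_1, …, x_q`. -/
theorem isClosed_range_rationalNormalCurve (hq : 0 < q)
    (hθ : ∀ a ≤ q, ∀ b ≤ q, θ a (e b) = if a = b then 1 else 0)
    (hf : ∀ p, ι (f p) =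
      Projectivization.mk k _ (rationalNormalCurve_ne_zero hθ p.rep_nonzero)) :
    IsClosed (ι '' Set.range f) := by
  have hset : ι '' Set.range f =
      (⋂ φ : Module.Dual k E, {x : ℙ k E | φ x.rep -
        ∑ c ∈ Finset.range (q + 1), θ c x.rep * φ (e c) = 0}) ∩
      ⋂ a ∈ Finset.range q, ⋂ b ∈ Finset.range q,
        {x : ℙ k E | θ a x.rep * θ (b + 1) x.rep - θ (a + 1) x.rep * θ b x.rep = 0} := by
    ext x
    simp only [Set.mem_image, Set.mem_range, exists_exists_eq_and, Set.mem_inter_iff,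
      Set.mem_iInter, Set.mem_ofPred_eq, Finset.mem_range]
    constructor
    · rintro ⟨p, rfl⟩
      rw [hf]
      obtain ⟨a, ha⟩ := Projectivization.exists_smul_eq_mk_rep k _
        (rationalNormalCurve_ne_zero hθ p.rep_nonzero)
      rw [← ha]
      simp only [Units.smul_def, map_smul, smul_eq_mul]
      constructor
      · intro φ
        conv_lhs =>
          enter [1]
          rw [linear_relations_of_rationalNormalCurve hθ]
        rw [map_sum, Finset.mul_sum, sub_eq_zero]
        simp only [map_smul, smul_eq_mul]
        exact Finset.sum_congr rfl fun c _ => by ring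
      · intro b hb c hc
        rw [dual_rationalNormalCurve hθ hb.le, dual_rationalNormalCurve hθ hc.le,
          dual_rationalNormalCurve hθ (show b + 1 ≤ q from hb),
          dual_rationalNormalCurve hθ (show c + 1 ≤ q from hc)]
        obtain ⟨m, hm⟩ : ∃ m, q = b + 1 + m := ⟨q - b - 1, by omega⟩
        obtain ⟨n, hn⟩ : ∃ n, q = c + 1 + n := ⟨q - c - 1, by omega⟩
        rw [show q - b = m + 1 by omega, show q - c = n + 1 by omega,
          show q - (c + 1) = n by omega, show q - (b + 1) = m by omega]
        ring
    · rintro ⟨hlin, hquad⟩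
      have hlin' : x.rep = ∑ c ∈ Finset.range (q + 1), θ c x.rep • e c := by
        rw [← sub_eq_zero]
        refine (Module.forall_dual_apply_eq_zero_iff k _).1 fun φ => ?_
        simpa using hlin φ
      obtain ⟨v, hv, r, hr, hvr⟩ := exists_rationalNormalCurve_eq hq x.rep_nonzero hlin'
        fun a ha b hb => sub_eq_zero.1 (hquad a ha b hb)
      refine ⟨Projectivization.mk k v hv, ?_⟩
      rw [hf, ← Projectivization.mk_rep x, Projectivization.mk_eq_mk_iff']
      obtain ⟨a, ha⟩ := Projectivization.exists_smul_eq_mk_rep k v hv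
      refine ⟨a ^ q * r⁻¹, ?_⟩
      rw [← ha, Units.smul_def, (isHomogeneousMap_rationalNormalCurve q e).smul]
      conv_lhs => rw [hvr]
      rw [smul_smul]
      congr 1
      field_simp
  rw [hset]
  refine IsClosed.inter (isClosed_iInter fun φ => ?_) ?_
  · exact ((IsHomogeneousFun.linear φ).sub (IsHomogeneousFun.sum _ fun c _ =>
      (IsHomogeneousFun.linear (θ c)).mul (IsHomogeneousFun.const (φ (e c))))).isClosed
  · refine isClosed_biInter fun a _ => isClosed_biInter fun b _ => ?_
    exact (((IsHomogeneousFun.linear (θ a)).mul (IsHomogeneousFun.linear (θ (b + 1)))).sub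
      ((IsHomogeneousFun.linear (θ (a + 1))).mul (IsHomogeneousFun.linear (θ b)))).isClosed

theorem isHomogeneousMap_pair (θ₀ θ₁ : Module.Dual k E) :
    IsHomogeneousMap k 1 (fun w => ![θ₀ w, θ₁ w]) := by
  intro φ
  have h : ∀ w : E, φ ![θ₀ w, θ₁ w] = (φ ![1, 0] • θ₀ + φ ![0, 1] • θ₁) w := by
    intro w
    have : (![θ₀ w, θ₁ w] : Fin 2 → k) = θ₀ w • ![1, 0] + θ₁ w • ![0, 1] := by
      ext j; fin_cases j <;> simp
    rw [this, map_add, map_smul, map_smul]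
    simp [mul_comm]
  simp only [h]
  exact IsHomogeneousFun.linear _

/-- A rational normal curve of positive degree is a projective line. -/
theorem isProjectiveLineIn_range_rationalNormalCurve (hq : 0 < q)
    (hθ : ∀ a ≤ q, ∀ b ≤ q, θ a (e b) = if a = b then 1 else 0)
    (hf : ∀ p, ι (f p) =
      Projectivization.mk k _ (rationalNormalCurve_ne_zero hθ p.rep_nonzero)) :
    IsProjectiveLineIn ι (Set.range f) := by
  have hinj : Function.Injective f := by
    intro p p' h
    have h' := hf p
    rw [h, hf p', Projectivization.mk_eq_mk_iff'] at h'
    obtain ⟨r, hr⟩ := h'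
    have := mk_rationalNormalCurve_injective hq hθ p'.rep_nonzero p.rep_nonzero hr.symm
    simpa using this.symm
  refine ⟨isClosed_range_rationalNormalCurve hq hθ hf, Equiv.ofInjective f hinj, ?_, ?_⟩
  · intro p
    exact ⟨Set.univ, q, _, isOpen_univ, trivial, isHomogeneousMap_rationalNormalCurve q e,
      fun p _ => ⟨_, hf p⟩⟩
  · obtain ⟨q, rfl⟩ : ∃ m, q = m + 1 := ⟨q - 1, by omega⟩
    -- Two coordinates equal to `r * v 0` and `r * v 1` recover the parameter. On `x_0 ≠ 0` the
    -- coordinates of index `1, 0` do so with `r = v 1 ^ q`, and on `x_(q+1) ≠ 0` those of index `q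
    -- + 1, q` with `r = v 0 ^ q`. These two charts cover the curve.
    have local_inverse : ∀ (p : ℙ k (Fin 2 → k)) (a b : ℕ) (ha : a ≤ q + 1) (hb : b ≤ q + 1)
        (r : k) (hr : r ≠ 0) (h0 : p.rep 0 ^ a * p.rep 1 ^ (q + 1 - a) = r * p.rep 0)
        (h1 : p.rep 0 ^ b * p.rep 1 ^ (q + 1 - b) = r * p.rep 1),
        ∃ h : ![θ a (ι (f p)).rep, θ b (ι (f p)).rep] ≠ 0,
          p = Projectivization.mk k ![θ a (ι (f p)).rep, θ b (ι (f p)).rep] h := by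
      intro p a b ha hb r hr h0 h1
      rw [hf]
      obtain ⟨s, hs⟩ := Projectivization.exists_smul_eq_mk_rep k _
        (rationalNormalCurve_ne_zero hθ p.rep_nonzero)
      rw [← hs]
      have hd : ∀ c ≤ q + 1, θ c (s • rationalNormalCurve (q + 1) e p.rep) =
          s * (p.rep 0 ^ c * p.rep 1 ^ (q + 1 - c)) := fun c hc => by
        rw [Units.smul_def, map_smul, dual_rationalNormalCurve hθ hc, smul_eq_mul]
      simp only [hd a ha, hd b hb, h0, h1]
      have heq : (![s * (r * p.rep 0), s * (r * p.rep 1)] : Fin 2 → k) = (s * r : k) • p.rep := by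
        ext j; fin_cases j <;> simp [mul_assoc]
      have hne : (![s * (r * p.rep 0), s * (r * p.rep 1)] : Fin 2 → k) ≠ 0 := by
        rw [heq]
        exact smul_ne_zero (mul_ne_zero s.ne_zero hr) p.rep_nonzero
      refine ⟨hne, ?_⟩
      conv_lhs => rw [← Projectivization.mk_rep p]
      rw [eq_comm, Projectivization.mk_eq_mk_iff']
      exact ⟨_, heq.symm⟩
    have hθf : ∀ (p : ℙ k (Fin 2 → k)) (a : ℕ), a ≤ q + 1 →
        (θ a (ι (f p)).rep ≠ 0 ↔ p.rep 0 ^ a * p.rep 1 ^ (q + 1 - a) ≠ 0) := by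
      intro p a ha
      rw [hf, (IsHomogeneousFun.linear (θ a)).ne_zero_iff_of_mk_eq,
        dual_rationalNormalCurve hθ ha]
    have hsymm : ∀ (p : ℙ k (Fin 2 → k)) (h : f p ∈ Set.range f),
        (Equiv.ofInjective f hinj).symm ⟨f p, h⟩ = p := fun p h =>
      Equiv.ofInjective_symm_apply hinj p
    rintro ⟨_, p, rfl⟩
    by_cases hp : p.rep 0 = 0
    · have hp1 : p.rep 1 ≠ 0 := fun h1 => p.rep_nonzero (by ext j; fin_cases j <;> assumption)
      refine ⟨{x | θ 0 x.rep ≠ 0}, 1, fun w => ![θ 1 w, θ 0 w],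
        (IsHomogeneousFun.linear (θ 0)).isOpen, ?_, isHomogeneousMap_pair _ _, ?_⟩
      · exact (hθf p 0 (Nat.zero_le _)).2 (by simp [hp1])
      · rintro ⟨_, p', rfl⟩ hp'
        have h1 : p'.rep 1 ≠ 0 := by
          have := (hθf p' 0 (Nat.zero_le _)).1 hp'
          simpa using this
        obtain ⟨h, h'⟩ := local_inverse p' 1 0 (by omega) (by omega) (p'.rep 1 ^ q)
          (pow_ne_zero _ h1) (by simp [mul_comm]) (by simp [pow_succ])
        exact ⟨h, (hsymm p' _).trans h'⟩
    · refine ⟨{x | θ (q + 1) x.rep ≠ 0}, 1, fun w => ![θ (q + 1) w, θ q w],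
        (IsHomogeneousFun.linear (θ (q + 1))).isOpen, ?_, isHomogeneousMap_pair _ _, ?_⟩
      · exact (hθf p _ le_rfl).2 (by simp [hp])
      · rintro ⟨_, p', rfl⟩ hp'
        have h1 : p'.rep 0 ≠ 0 := by
          have := (hθf p' _ le_rfl).1 hp'
          simpa using this
        obtain ⟨h, h'⟩ := local_inverse p' (q + 1) q le_rfl (by omega) (p'.rep 0 ^ q)
          (pow_ne_zero _ h1) (by simp [pow_succ]) (by simp)
        exact ⟨h, (hsymm p' _).trans h'⟩

end RationalNormalCurve

/-! ### Pencils of subspaces in Plücker coordinates. -/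

section Pencil

variable {k : Type*} [Field k] {M : Type*} [AddCommGroup M] [Module k M] {i : ℕ}

/-- The family which agrees with `x` outside of `J`, and is the linear combination of `x` and `y`
with coefficients `v` on `J`. -/
def pencil (x y : Fin i → M) (J : Finset (Fin i)) (v : Fin 2 → k) (b : Fin i) : M :=
  if b ∈ J then v 0 • x b + v 1 • y b else x b

/-- The coefficients of the expansion of the exterior product of a pencil. -/
noncomputable def pencilCoeff (k : Type*) [Field k] [Module k M] (x y : Fin i → M)
    (J : Finset (Fin i)) (c : ℕ) : ⋀[k]^i M :=
  ∑ s : Finset (Fin i), if Jᶜ ⊆ s ∧ (s ∩ J).card = c then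
    exteriorPower.ιMulti k i (s.piecewise x y) else 0

/-- Multilinear expansion. A subset `s` records where the `x`-summand is chosen; outside `J` there
is no other choice, so only `s ⊇ Jᶜ` contributes, with coefficient `v 0 ^ |s ∩ J| * v 1 ^ |J \ s|`.
-/
theorem ιMulti_pencil (x y : Fin i → M) (J : Finset (Fin i)) (v : Fin 2 → k) :
    exteriorPower.ιMulti k i (pencil x y J v) =
      rationalNormalCurve J.card (pencilCoeff k x y J) v := by
  have h1 : pencil x y J v = (fun b => (if b ∈ J then v 0 else 1) • x b) +
      fun b => (if b ∈ J then v 1 else 0) • y b := by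
    funext b
    by_cases hb : b ∈ J <;> simp [pencil, hb]
  have h2 : ∀ s : Finset (Fin i),
      s.piecewise (fun b => (if b ∈ J then v 0 else 1) • x b)
        (fun b => (if b ∈ J then v 1 else 0) • y b) =
      fun b => (if b ∈ s then (if b ∈ J then v 0 else 1) else (if b ∈ J then v 1 else 0)) •
        (s.piecewise x y) b := by
    intro s
    funext b
    by_cases hb : b ∈ s <;> simp [hb]
  have h3 : ∀ s : Finset (Fin i),
      (∏ b, if b ∈ s then (if b ∈ J then v 0 else 1) else (if b ∈ J then v 1 else 0)) =
      if Jᶜ ⊆ s then v 0 ^ (s ∩ J).card * v 1 ^ (J.card - (s ∩ J).card) else 0 := by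
    intro s
    split_ifs with hs
    · have : ∀ b, (if b ∈ s then (if b ∈ J then v 0 else 1) else (if b ∈ J then v 1 else 0)) =
          (if b ∈ s ∩ J then v 0 else 1) * (if b ∈ J \ s then v 1 else 1) := by
        intro b
        by_cases hb : b ∈ s <;> by_cases hb' : b ∈ J <;> simp [hb, hb']
        exact absurd (hs (Finset.mem_compl.2 hb')) hb
      rw [Finset.prod_congr rfl fun b _ => this b, Finset.prod_mul_distrib,
        Finset.prod_ite_mem, Finset.prod_ite_mem, Finset.univ_inter, Finset.univ_inter,
        Finset.prod_const, Finset.prod_const, Finset.card_sdiff]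
    · obtain ⟨b, hb, hbs⟩ := Finset.not_subset.1 hs
      exact Finset.prod_eq_zero (Finset.mem_univ b) (by
        rw [if_neg hbs, if_neg (Finset.mem_compl.1 hb)])
  rw [h1]
  have h4 := (exteriorPower.ιMulti k i (M := M)).toMultilinearMap.map_add_univ
    (fun b => (if b ∈ J then v 0 else 1) • x b) (fun b => (if b ∈ J then v 1 else 0) • y b)
  refine (h4.trans ?_)
  simp only [h2, MultilinearMap.map_smul_univ, h3, rationalNormalCurve, pencilCoeff,
    Finset.smul_sum]
  rw [Finset.sum_comm]
  refine Finset.sum_congr rfl fun s _ => ?_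
  rw [Finset.sum_eq_single (s ∩ J).card]
  · by_cases hs : Jᶜ ⊆ s <;> simp [hs]
  · intro c _ hc
    rw [if_neg fun h => hc h.2.symm, smul_zero]
  · intro h
    exact absurd (Finset.mem_range.2 (Nat.lt_succ_of_le
      (Finset.card_le_card Finset.inter_subset_right))) h

theorem LinearIndependent.exists_dual_family {κ : Type*} [DecidableEq κ] {w : κ → M}
    (hw : LinearIndependent k w) :
    ∃ δ : κ → Module.Dual k M, ∀ a b, δ a (w b) = if a = b then 1 else 0 := by
  obtain ⟨g, hg⟩ := LinearMap.exists_leftInverse_of_injective (Finsupp.linearCombination k w)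
    (LinearMap.ker_eq_bot.2 hw)
  refine ⟨fun a => Finsupp.lapply a ∘ₗ g, fun a b => ?_⟩
  have := LinearMap.congr_fun hg (Finsupp.single b 1)
  simp only [LinearMap.comp_apply, Finsupp.linearCombination_single, one_smul,
    LinearMap.id_apply] at this
  simp [this, Finsupp.single_apply, eq_comm]

variable {x y : Fin i → M} {J : Finset (Fin i)} {ξ η : Fin i → Module.Dual k M}

/-- To isolate coefficient `a`, take `S ⊆ J` with `a` elements and the exterior product of the forms
`η j` for `j ∈ J \ S` and `ξ j` otherwise. Paired with the pencil it gives the determinant of a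
diagonal matrix, namely the single monomial `v 0 ^ a * v 1 ^ (|J| - a)`. Hence the pencil is a
genuine rational normal curve of degree `|J|`. -/
theorem exists_dual_pencilCoeff [Infinite k]
    (hξx : ∀ a b, ξ a (x b) = if a = b then 1 else 0)
    (hξy : ∀ a, ∀ b ∈ J, ξ a (y b) = 0)
    (hηx : ∀ a ∈ J, ∀ b, η a (x b) = 0)
    (hηy : ∀ a ∈ J, ∀ b ∈ J, η a (y b) = if a = b then 1 else 0) :
    ∃ θ : ℕ → Module.Dual k (⋀[k]^i M), ∀ a ≤ J.card, ∀ b ≤ J.card,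
      θ a (pencilCoeff k x y J b) = if a = b then 1 else 0 := by
  have main : ∀ a ≤ J.card, ∃ θ : Module.Dual k (⋀[k]^i M), ∀ b ≤ J.card,
      θ (pencilCoeff k x y J b) = if a = b then 1 else 0 := by
    intro a ha
    obtain ⟨S, hSJ, rfl⟩ := Finset.exists_subset_card_eq ha
    refine ⟨exteriorPower.pairingDual k M i
      (exteriorPower.ιMulti k i fun j => if j ∈ J \ S then η j else ξ j), ?_⟩
    set θ := exteriorPower.pairingDual k M i
      (exteriorPower.ιMulti k i fun j => if j ∈ J \ S then η j else ξ j) with hθ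
    have hval : ∀ v : Fin 2 → k, θ (rationalNormalCurve J.card (pencilCoeff k x y J) v) =
        v 0 ^ S.card * v 1 ^ (J.card - S.card) := by
      intro v
      rw [← ιMulti_pencil, hθ, exteriorPower.pairingDual_ιMulti_ιMulti]
      have hdiag : (Matrix.of fun b j => (if j ∈ J \ S then η j else ξ j) (pencil x y J v b)) =
          Matrix.diagonal fun j => (if j ∈ S then v 0 else 1) * (if j ∈ J \ S then v 1 else 1) := by
        ext b j
        rw [Matrix.of_apply, Matrix.diagonal_apply]
        by_cases hj : j ∈ J
        · by_cases hjS : j ∈ S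
          · by_cases hb : b ∈ J
            · by_cases hbj : b = j
              · subst hbj
                simp [pencil, hj, hjS, hξx, hξy]
              · simp [pencil, hj, hjS, hb, hξx, hξy, hbj, Ne.symm hbj]
            · have hne : b ≠ j := by rintro rfl; exact hb hj
              simp [pencil, hjS, hb, hξx, hne, hne.symm]
          · by_cases hb : b ∈ J
            · by_cases hbj : b = j
              · subst hbj
                simp [pencil, hj, hjS, hηx, hηy]
              · simp [pencil, hj, hjS, hb, hηx, hηy, hbj, Ne.symm hbj]
            · have hne : b ≠ j := by rintro rfl; exact hb hj
              simp [pencil, hj, hjS, hb, hηx, hne]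
        · have hjS : j ∉ S := fun h => hj (hSJ h)
          by_cases hb : b ∈ J
          · have hne : b ≠ j := by rintro rfl; exact hj hb
            simp [pencil, hj, hb, hξx, hξy, hne, hne.symm]
          · by_cases hbj : b = j
            · subst hbj
              simp [pencil, hj, hjS, hξx]
            · simp [pencil, hj, hjS, hb, hξx, hbj, Ne.symm hbj]
      rw [hdiag, Matrix.det_diagonal, Finset.prod_mul_distrib, Finset.prod_ite_mem,
        Finset.prod_ite_mem, Finset.univ_inter, Finset.univ_inter, Finset.prod_const,
        Finset.prod_const, Finset.card_sdiff_of_subset hSJ]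
    -- Setting `v = (t, 1)` gives an identity for all `t` in the infinite field `k`, hence an
    -- identity of polynomials whose coefficients can be compared.
    have hpoly : (∑ c ∈ Finset.range (J.card + 1),
        Polynomial.C (θ (pencilCoeff k x y J c)) * Polynomial.X ^ c) =
        (Polynomial.X ^ S.card : Polynomial k) := by
      refine Polynomial.funext fun t => ?_
      have := hval ![t, 1]
      simp only [rationalNormalCurve, map_sum, map_smul, smul_eq_mul] at this
      simp only [Polynomial.eval_finsetSum, Polynomial.eval_mul, Polynomial.eval_C,
        Polynomial.eval_pow, Polynomial.eval_X]
      simpa [mul_comm] using this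
    intro b hb
    have := congrArg (fun P => Polynomial.coeff P b) hpoly
    simp only [Polynomial.finsetSum_coeff, Polynomial.coeff_C_mul, Polynomial.coeff_X_pow] at this
    rw [Finset.sum_eq_single b] at this
    · simpa [eq_comm] using this
    · intro c _ hc
      rw [if_neg hc.symm, mul_zero]
    · intro h
      exact absurd (Finset.mem_range.2 (by omega)) h
  choose! θ hθ using main
  exact ⟨θ, hθ⟩

variable {A : Type*} [Ring A] [Algebra k A] [Module A M] [IsScalarTower k A M]
  [FiniteDimensional k M]

theorem plucker_eq_mk (U : QuiverGrassmannian k A M i) {m : Fin i → M}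
    (hm : ∀ b, m b ∈ U.toSubmodule) (hne : exteriorPower.ιMulti k i m ≠ 0) :
    U.plucker = Projectivization.mk k _ hne := by
  apply Projectivization.submodule_injective
  rw [QuiverGrassmannian.plucker, Projectivization.submodule_mk'', Projectivization.submodule_mk]
  symm
  refine Submodule.eq_of_le_of_finrank_eq ?_ ?_
  · rw [Submodule.span_singleton_le_iff_mem]
    refine ⟨exteriorPower.ιMulti k i fun b => ⟨m b, hm b⟩, ?_⟩
    rw [exteriorPower.map_apply_ιMulti]
    rfl
  · rw [finrank_span_singleton hne, U.finrank_plucker]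

/-- A pencil all of whose members span submodules is a projective line in the quiver
Grassmannian. -/
theorem exists_line_of_pencil [Infinite k] (hJ : J.Nonempty)
    (hξx : ∀ a b, ξ a (x b) = if a = b then 1 else 0)
    (hξy : ∀ a, ∀ b ∈ J, ξ a (y b) = 0)
    (hηx : ∀ a ∈ J, ∀ b, η a (x b) = 0)
    (hηy : ∀ a ∈ J, ∀ b ∈ J, η a (y b) = if a = b then 1 else 0)
    (hstab : ∀ (v : Fin 2 → k) (a : A), ∀ m ∈ Submodule.span k (Set.range (pencil x y J v)),
      a • m ∈ Submodule.span k (Set.range (pencil x y J v))) :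
    ∃ f : ℙ k (Fin 2 → k) → QuiverGrassmannian k A M i,
      (∀ p b, pencil x y J p.rep b ∈ (f p).toSubmodule) ∧
      IsRationalCurve J.card QuiverGrassmannian.plucker f ∧
      IsProjectiveLineIn QuiverGrassmannian.plucker (Set.range f) := by
  obtain ⟨θ, hθ⟩ := exists_dual_pencilCoeff hξx hξy hηx hηy
  have hne : ∀ p : ℙ k (Fin 2 → k), exteriorPower.ιMulti k i (pencil x y J p.rep) ≠ 0 := by
    intro p
    rw [ιMulti_pencil]
    exact rationalNormalCurve_ne_zero hθ p.rep_nonzero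
  have hli : ∀ p : ℙ k (Fin 2 → k), LinearIndependent k (pencil x y J p.rep) := by
    intro p
    by_contra h
    exact hne p (AlternatingMap.map_linearDependent _ _ h)
  let f : ℙ k (Fin 2 → k) → QuiverGrassmannian k A M i := fun p =>
    { toSubmodule :=
        { Submodule.span k (Set.range (pencil x y J p.rep)) with
          smul_mem' := fun a m hm => hstab p.rep a m hm }
      finrank_eq := (finrank_span_eq_card (hli p)).trans (Fintype.card_fin i) }
  have hf : ∀ p b, pencil x y J p.rep b ∈ (f p).toSubmodule := fun p b =>
    Submodule.subset_span (R := k) ⟨b, rfl⟩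
  have hpl : ∀ p, (f p).plucker = Projectivization.mk k _
      (rationalNormalCurve_ne_zero hθ p.rep_nonzero) := by
    intro p
    rw [plucker_eq_mk (f p) (hf p) (hne p)]
    simp only [ιMulti_pencil]
  exact ⟨f, hf, isRationalCurve_rationalNormalCurve (fun _ hv => rationalNormalCurve_ne_zero hθ hv)
    hpl, isProjectiveLineIn_range_rationalNormalCurve hJ.card_pos hθ hpl⟩

end Pencil

/-! ### Lines joining two points of a quiver Grassmannian. -/

section Lines

variable {k : Type*} [Field k] {M : Type*} [AddCommGroup M] [Module k M]

theorem Submodule.exists_relative_compl (I U : Submodule k M) (h : I ≤ U) :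
    ∃ C ≤ U, I ⊓ C = ⊥ ∧ I ⊔ C = U := by
  obtain ⟨C, hC⟩ := Submodule.exists_isCompl I
  refine ⟨C ⊓ U, inf_le_right, ?_, ?_⟩
  · rw [← inf_assoc, hC.inf_eq_bot, bot_inf_eq]
  · rw [← sup_inf_assoc_of_le _ h, hC.sup_eq_top, top_inf_eq]

variable [FiniteDimensional k M]

theorem Submodule.exists_between_finrank (N P : Submodule k M) (h : N ≤ P) {d : ℕ}
    (h1 : Module.finrank k N ≤ d) (h2 : d ≤ Module.finrank k P) :
    ∃ Q : Submodule k M, N ≤ Q ∧ Q ≤ P ∧ Module.finrank k Q = d := by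
  induction d, h1 using Nat.le_induction with
  | base => exact ⟨N, le_rfl, h, rfl⟩
  | succ d _ ih =>
    obtain ⟨Q, hNQ, hQP, hQ⟩ := ih (by omega)
    obtain ⟨z, hzP, hzQ⟩ : ∃ z ∈ P, z ∉ Q := by
      by_contra! hc
      have := Submodule.finrank_mono (show P ≤ Q from hc)
      omega
    refine ⟨Q ⊔ Submodule.span k {z}, hNQ.trans le_sup_left,
      sup_le hQP ((Submodule.span_singleton_le_iff_mem _ _).2 hzP), ?_⟩
    have hz0 : z ≠ 0 := fun h0 => hzQ (h0 ▸ Q.zero_mem)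
    have hdis : Q ⊓ Submodule.span k {z} = ⊥ :=
      ((Submodule.disjoint_span_singleton' hz0).2 hzQ).eq_bot
    have := Submodule.finrank_sup_add_finrank_inf_eq Q (Submodule.span k {z})
    rw [hdis, finrank_bot, finrank_span_singleton hz0] at this
    omega

variable {A : Type*} [Ring A] [Algebra k A] [Module A M] [IsScalarTower k A M] {i : ℕ}

theorem QuiverGrassmannian.eq_of_le {U V : QuiverGrassmannian k A M i}
    (h : U.toSubmodule ≤ V.toSubmodule) : U = V := by
  have := Submodule.eq_of_le_of_finrank_eq (K := k)
    (S₁ := U.toSubmodule.restrictScalars k) (S₂ := V.toSubmodule.restrictScalars k) h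
    (U.finrank_eq.trans V.finrank_eq.symm)
  have h' : U.toSubmodule = V.toSubmodule := Submodule.restrictScalars_injective k A M this
  cases U
  cases V
  cases h'
  rfl

/-- Two different points `U`, `U'` of a quiver Grassmannian such that the algebra acts by scalars
on `U + U'` modulo `U ∩ U'` lie on a projective line, which is also a rational curve. -/
theorem QuiverGrassmannian.exists_line [Infinite k] (U U' : QuiverGrassmannian k A M i)
    (hne : U ≠ U')
    (hA : ∀ a : A, ∃ r : k, ∀ m : M, m ∈ U.toSubmodule ∨ m ∈ U'.toSubmodule →
      a • m - r • m ∈ U.toSubmodule ⊓ U'.toSubmodule) :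
    ∃ f : ℙ k (Fin 2 → k) → QuiverGrassmannian k A M i,
      IsRationalCurve i plucker f ∧ IsProjectiveLineIn plucker (Set.range f) ∧
      U ∈ Set.range f ∧ U' ∈ Set.range f := by
  classical
  let P := U.toSubmodule.restrictScalars k
  let P' := U'.toSubmodule.restrictScalars k
  have hP : Module.finrank k P = i := U.finrank_eq
  have hP' : Module.finrank k P' = i := U'.finrank_eq
  -- Split `U = (U ∩ U') ⊕ C` and `U' = (U ∩ U') ⊕ D`. The three pieces are independent and `C`, `D`
  -- have the same dimension `q`; the pencil keeps a basis of `U ∩ U'` fixed and moves a basis of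
  -- `C` to one of `D`.
  obtain ⟨C, hCP, hIC, hIC'⟩ := Submodule.exists_relative_compl (P ⊓ P') P inf_le_left
  obtain ⟨D, hDP, hID, hID'⟩ := Submodule.exists_relative_compl (P ⊓ P') P' inf_le_right
  have hdC := Submodule.finrank_sup_add_finrank_inf_eq (P ⊓ P') C
  have hdD := Submodule.finrank_sup_add_finrank_inf_eq (P ⊓ P') D
  rw [hIC, hIC', finrank_bot, add_zero, hP] at hdC
  rw [hID, hID', finrank_bot, add_zero, hP'] at hdD
  obtain ⟨p, hp⟩ : ∃ p, Module.finrank k ↥(P ⊓ P') = p := ⟨_, rfl⟩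
  obtain ⟨q, hq⟩ : ∃ q, Module.finrank k C = q := ⟨_, rfl⟩
  rw [hp, hq] at hdC
  let u := Module.finBasisOfFinrankEq k ↥(P ⊓ P') hp
  let v := Module.finBasisOfFinrankEq k C hq
  let v' := Module.finBasisOfFinrankEq k D (show Module.finrank k D = q by omega)
  have su : Submodule.span k (Set.range fun b => (u b : M)) = P ⊓ P' := by
    have := congrArg (Submodule.map (P ⊓ P').subtype) u.span_eq
    rwa [Submodule.map_span, Submodule.map_top, Submodule.range_subtype, ← Set.range_comp] at this
  have sv : Submodule.span k (Set.range fun b => (v b : M)) = C := by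
    have := congrArg (Submodule.map C.subtype) v.span_eq
    rwa [Submodule.map_span, Submodule.map_top, Submodule.range_subtype, ← Set.range_comp] at this
  have sv' : Submodule.span k (Set.range fun b => (v' b : M)) = D := by
    have := congrArg (Submodule.map D.subtype) v'.span_eq
    rwa [Submodule.map_span, Submodule.map_top, Submodule.range_subtype, ← Set.range_comp] at this
  have lu : LinearIndependent k fun b => (u b : M) :=
    u.linearIndependent.map' (P ⊓ P').subtype (Submodule.ker_subtype _)
  have lv : LinearIndependent k fun b => (v b : M) :=
    v.linearIndependent.map' C.subtype (Submodule.ker_subtype _)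
  have lv' : LinearIndependent k fun b => (v' b : M) :=
    v'.linearIndependent.map' D.subtype (Submodule.ker_subtype _)
  have luv : LinearIndependent k (Sum.elim (fun b => (u b : M)) fun b => (v b : M)) :=
    lu.sum_type lv (by rw [su, sv]; exact disjoint_iff.2 hIC)
  have luvv : LinearIndependent k (Sum.elim (Sum.elim (fun b => (u b : M)) fun b => (v b : M))
      fun b => (v' b : M)) := by
    refine luv.sum_type lv' ?_
    rw [Set.Sum.elim_range, Submodule.span_union, su, sv, sv', hIC', disjoint_iff, eq_bot_iff]
    intro m hm
    rw [← hID]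
    exact ⟨⟨hm.1, hDP hm.2⟩, hm.2⟩
  obtain ⟨δ, hδ⟩ := luvv.exists_dual_family
  let σ : Fin p ⊕ Fin q ≃ Fin i := finSumFinEquiv.trans (finCongr hdC.symm)
  let x : Fin i → M := fun b => Sum.elim (fun b => (u b : M)) (fun b => (v b : M)) (σ.symm b)
  let y : Fin i → M := fun b => Sum.elim (fun b => (u b : M)) (fun b => (v' b : M)) (σ.symm b)
  let J : Finset (Fin i) := Finset.univ.filter fun b => (σ.symm b).isRight
  have hJ : ∀ b, b ∈ J ↔ ∃ c, b = σ (Sum.inr c) := by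
    intro b
    obtain ⟨b | b, rfl⟩ := σ.surjective b <;> simp [J]
  have hJcard : J.card ≤ i := (Finset.card_le_univ J).trans (Fintype.card_fin i).le
  have hq0 : 0 < q := by
    rcases Nat.eq_zero_or_pos q with rfl | h
    · exfalso
      have hC0 : C = ⊥ := Submodule.finrank_eq_zero.1 hq
      rw [hC0, sup_bot_eq] at hIC'
      exact hne (eq_of_le (show P ≤ P' from inf_eq_left.1 hIC'))
    · exact h
  have hmem : ∀ (w : Fin 2 → k) b, pencil x y J w b ∈ P ⊔ P' := by
    intro w b
    obtain ⟨b | b, rfl⟩ := σ.surjective b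
    · have : σ (Sum.inl b) ∉ J := by simp [hJ]
      simp only [pencil, this, if_false, x, Equiv.symm_apply_apply, Sum.elim_inl]
      exact Submodule.mem_sup_left (u b).2.1
    · have : σ (Sum.inr b) ∈ J := by simp [hJ]
      simp only [pencil, this, if_true, x, y, Equiv.symm_apply_apply, Sum.elim_inr]
      exact Submodule.add_mem_sup (P.smul_mem _ (hCP (v b).2)) (P'.smul_mem _ (hDP (v' b).2))
  have hI : ∀ w : Fin 2 → k, P ⊓ P' ≤ Submodule.span k (Set.range (pencil x y J w)) := by
    intro w
    rw [← su, Submodule.span_le]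
    rintro _ ⟨b, rfl⟩
    refine Submodule.subset_span ⟨σ (Sum.inl b), ?_⟩
    have : σ (Sum.inl b) ∉ J := by simp [hJ]
    simp [pencil, this, x]
  -- The forms `ξ` are dual to the basis of `U` and the forms `η` to that of `D`. Outside `J` the
  -- values of `y` and `η` play no role.
  obtain ⟨f, hf, hfr, hfl⟩ := exists_line_of_pencil (A := A) (x := x) (y := y) (J := J)
    (ξ := fun b => δ (Sum.inl (σ.symm b)))
    (η := fun b => Sum.elim (fun _ => 0) (fun b => δ (Sum.inr b)) (σ.symm b))
    ⟨σ (Sum.inr ⟨0, hq0⟩), (hJ _).2 ⟨_, rfl⟩⟩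
    (by
      intro a b
      have := hδ (Sum.inl (σ.symm a)) (Sum.inl (σ.symm b))
      simpa using this)
    (by
      intro a b hb
      obtain ⟨b, rfl⟩ := (hJ b).1 hb
      have := hδ (Sum.inl (σ.symm a)) (Sum.inr b)
      simpa [y] using this)
    (by
      intro a ha b
      obtain ⟨a, rfl⟩ := (hJ a).1 ha
      have := hδ (Sum.inr a) (Sum.inl (σ.symm b))
      simpa [x] using this)
    (by
      intro a ha b hb
      obtain ⟨a, rfl⟩ := (hJ a).1 ha
      obtain ⟨b, rfl⟩ := (hJ b).1 hb
      have := hδ (Sum.inr a) (Sum.inr b)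
      simpa [y] using this)
    (by
      -- On `U + U'` the element `a` acts as a scalar up to an error in `U ∩ U'`, and `U ∩ U'` lies
      -- in every member of the pencil.
      intro w a m hm
      obtain ⟨r, hr⟩ := hA a
      have hle : Submodule.span k (Set.range (pencil x y J w)) ≤ P ⊔ P' :=
        Submodule.span_le.2 (by rintro _ ⟨b, rfl⟩; exact hmem w b)
      obtain ⟨m₁, h₁, m₂, h₂, rfl⟩ := Submodule.mem_sup.1 (hle hm)
      have key : a • (m₁ + m₂) =
          r • (m₁ + m₂) + ((a • m₁ - r • m₁) + (a • m₂ - r • m₂)) := by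
        rw [smul_add, smul_add]
        abel
      rw [key]
      refine add_mem (Submodule.smul_mem _ r hm) (hI w ?_)
      exact add_mem (S := Submodule k M) (s := P ⊓ P') (hr m₁ (Or.inl h₁)) (hr m₂ (Or.inr h₂)))
  refine ⟨f, hfr.mono hJcard, hfl, ?_, ?_⟩
  -- The parameters `[1 : 0]` and `[0 : 1]` give `U` and `U'`. Since `rep` is only known up to a
  -- unit, the moving vectors are divided by that unit.
  · have h10 : (![1, 0] : Fin 2 → k) ≠ 0 := fun h => one_ne_zero (congrFun h 0)
    refine ⟨Projectivization.mk k ![1, 0] h10, (eq_of_le ?_).symm⟩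
    obtain ⟨a, ha⟩ := Projectivization.exists_smul_eq_mk_rep k _ h10
    set F := (f (Projectivization.mk k ![1, 0] h10)).toSubmodule.restrictScalars k
    change P ≤ F
    have hfF : ∀ b, pencil x y J (Projectivization.mk k ![1, 0] h10).rep b ∈ F := hf _
    rw [← ha] at hfF
    rw [← hIC', ← su, ← sv, ← Submodule.span_union, Submodule.span_le]
    rintro _ (⟨b, rfl⟩ | ⟨b, rfl⟩)
    · have hb : σ (Sum.inl b) ∉ J := by simp [hJ]
      simpa [pencil, hb, x] using hfF (σ (Sum.inl b))
    · have hb : σ (Sum.inr b) ∈ J := by simp [hJ]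
      have := F.smul_mem (a⁻¹ : kˣ).val (hfF (σ (Sum.inr b)))
      simpa [pencil, hb, x, Units.smul_def, smul_smul] using this
  · have h01 : (![0, 1] : Fin 2 → k) ≠ 0 := fun h => one_ne_zero (congrFun h 1)
    refine ⟨Projectivization.mk k ![0, 1] h01, (eq_of_le ?_).symm⟩
    obtain ⟨a, ha⟩ := Projectivization.exists_smul_eq_mk_rep k _ h01
    set F := (f (Projectivization.mk k ![0, 1] h01)).toSubmodule.restrictScalars k
    change P' ≤ F
    have hfF : ∀ b, pencil x y J (Projectivization.mk k ![0, 1] h01).rep b ∈ F := hf _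
    rw [← ha] at hfF
    rw [← hID', ← su, ← sv', ← Submodule.span_union, Submodule.span_le]
    rintro _ (⟨b, rfl⟩ | ⟨b, rfl⟩)
    · have hb : σ (Sum.inl b) ∉ J := by simp [hJ]
      simpa [pencil, hb, x] using hfF (σ (Sum.inl b))
    · have hb : σ (Sum.inr b) ∈ J := by simp [hJ]
      have := F.smul_mem (a⁻¹ : kˣ).val (hfF (σ (Sum.inr b)))
      simpa [pencil, hb, y, Units.smul_def, smul_smul] using this

end Lines

/-! ### The local algebra with radical square zero. -/

namespace RadSquareZeroAlgebra

variable (k : Type u) [Field k] {n : ℕ}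

/-- The generators of the radical. -/
noncomputable def T (j : Fin n) : RadSquareZeroAlgebra k n :=
  Ideal.Quotient.mk _ (MvPolynomial.X j)

theorem T_mul_T (i j : Fin n) : T k i * T k j = 0 := by
  rw [T, T, ← map_mul, Ideal.Quotient.eq_zero_iff_mem, sq]
  exact Ideal.mul_mem_mul (Ideal.subset_span ⟨i, rfl⟩) (Ideal.subset_span ⟨j, rfl⟩)

variable (n) in
/-- The comparison with the trivial square zero extension. -/
noncomputable def toTrivSqZeroExt :
    RadSquareZeroAlgebra k n →ₐ[k] TrivSqZeroExt k (Fin n → k) :=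
  Ideal.Quotient.liftₐ _ (MvPolynomial.aeval fun j => TrivSqZeroExt.inr (Pi.single j 1)) (by
    intro a ha
    -- The variables go into the kernel of the projection to `k`, an ideal of square zero, so the
    -- square of the ideal they generate goes to zero.
    have hle : (Ideal.span (Set.range (MvPolynomial.X (R := k) (σ := Fin n)))).map
        (MvPolynomial.aeval (R := k) fun j : Fin n =>
          (TrivSqZeroExt.inr (Pi.single j 1) : TrivSqZeroExt k (Fin n → k))) ≤
        RingHom.ker (TrivSqZeroExt.fstHom k k (Fin n → k)) := by
      rw [Ideal.map_le_iff_le_comap, Ideal.span_le]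
      rintro _ ⟨j, rfl⟩
      simp [RingHom.mem_ker]
    have h2 := Ideal.mem_map_of_mem (MvPolynomial.aeval (R := k) fun j : Fin n =>
          (TrivSqZeroExt.inr (Pi.single j 1) : TrivSqZeroExt k (Fin n → k))) ha
    rw [Ideal.map_pow, sq] at h2
    have h3 : RingHom.ker (TrivSqZeroExt.fstHom k k (Fin n → k)) *
        RingHom.ker (TrivSqZeroExt.fstHom k k (Fin n → k)) = ⊥ := by
      rw [eq_bot_iff, Ideal.mul_le]
      intro r hr s hs
      rw [RingHom.mem_ker, TrivSqZeroExt.fstHom_apply] at hr hs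
      rw [Ideal.mem_bot]
      ext <;> simp [hr, hs]
    have h4 := Ideal.mul_mono hle hle h2
    rwa [h3, Ideal.mem_bot] at h4)

theorem toTrivSqZeroExt_T (j : Fin n) :
    toTrivSqZeroExt k n (T k j) = TrivSqZeroExt.inr (Pi.single j 1) :=
  (Ideal.Quotient.liftₐ_apply _ _ _ _).trans (MvPolynomial.aeval_X _ _)

theorem exists_sub_mem_span (a : RadSquareZeroAlgebra k n) :
    ∃ r : k, a - algebraMap k _ r ∈ Ideal.span (Set.range (T k (n := n))) := by
  obtain ⟨p, rfl⟩ := Ideal.Quotient.mk_surjective a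
  induction p using MvPolynomial.induction_on with
  | C r =>
    refine ⟨r, ?_⟩
    have : (Ideal.Quotient.mk ((Ideal.span (Set.range (MvPolynomial.X (R := k) (σ := Fin n)))) ^ 2))
      (MvPolynomial.C r) = algebraMap k (RadSquareZeroAlgebra k n) r := rfl
    rw [this, sub_self]
    exact zero_mem _
  | add p q hp hq =>
    obtain ⟨r, hr⟩ := hp
    obtain ⟨s, hs⟩ := hq
    refine ⟨r + s, ?_⟩
    rw [map_add, map_add, add_sub_add_comm]
    exact add_mem hr hs
  | mul_X p j hp =>
    refine ⟨0, ?_⟩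
    rw [map_zero, sub_zero, map_mul]
    exact Ideal.mul_mem_left _ _ (Ideal.subset_span ⟨j, rfl⟩)

theorem span_mul_span :
    Ideal.span (Set.range (T k (n := n))) * Ideal.span (Set.range (T k (n := n))) = ⊥ := by
  rw [eq_bot_iff, Ideal.mul_le]
  intro a ha b hb
  obtain ⟨c, rfl⟩ := Ideal.mem_span_range_iff_exists_fun.1 ha
  obtain ⟨d, rfl⟩ := Ideal.mem_span_range_iff_exists_fun.1 hb
  rw [Ideal.mem_bot, Finset.sum_mul_sum]
  refine Finset.sum_eq_zero fun i _ => Finset.sum_eq_zero fun j _ => ?_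
  rw [mul_mul_mul_comm, T_mul_T, mul_zero]

theorem mem_span_iff_exists (a : RadSquareZeroAlgebra k n) :
    a ∈ Ideal.span (Set.range (T k (n := n))) ↔ ∃ c : Fin n → k, a = ∑ j, c j • T k j := by
  constructor
  · intro h
    obtain ⟨c, rfl⟩ := Ideal.mem_span_range_iff_exists_fun.1 h
    choose r hr using fun j => exists_sub_mem_span k (c j)
    refine ⟨r, Finset.sum_congr rfl fun j _ => ?_⟩
    have := Ideal.mul_mem_mul (hr j) (Ideal.subset_span (s := Set.range (T k (n := n))) ⟨j, rfl⟩)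
    rw [span_mul_span, Ideal.mem_bot, sub_mul, sub_eq_zero] at this
    rw [this, Algebra.smul_def]
  · rintro ⟨c, rfl⟩
    refine sum_mem fun j _ => ?_
    rw [Algebra.smul_def]
    exact Ideal.mul_mem_left _ _ (Ideal.subset_span ⟨j, rfl⟩)

theorem exists_eq (a : RadSquareZeroAlgebra k n) :
    ∃ (r : k) (c : Fin n → k), a = algebraMap k _ r + ∑ j, c j • T k j := by
  obtain ⟨r, hr⟩ := exists_sub_mem_span k a
  obtain ⟨c, hc⟩ := (mem_span_iff_exists k _).1 hr
  exact ⟨r, c, by rw [← hc]; abel⟩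

instance finiteDimensional : FiniteDimensional k (RadSquareZeroAlgebra k n) := by
  refine Module.Finite.of_surjective (LinearMap.coprod
    (Algebra.linearMap k (RadSquareZeroAlgebra k n)) (Fintype.linearCombination k (T k (n := n))))
    fun a => ?_
  obtain ⟨r, c, rfl⟩ := exists_eq k a
  exact ⟨(r, c), by simp [Fintype.linearCombination_apply]⟩

/-- This ideal is the kernel of the augmentation `χ` onto `k`, as every element is a scalar modulo
the ideal. -/
theorem isMaximal_span : (Ideal.span (Set.range (T k (n := n)))).IsMaximal := by
  let χ := (TrivSqZeroExt.fstHom k k (Fin n → k)).comp (toTrivSqZeroExt k n)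
  have hχ : ∀ a ∈ Ideal.span (Set.range (T k (n := n))), χ a = 0 := by
    have : Ideal.span (Set.range (T k (n := n))) ≤ RingHom.ker χ := by
      rw [Ideal.span_le]
      rintro _ ⟨j, rfl⟩
      simp [χ, RingHom.mem_ker, toTrivSqZeroExt_T]
    exact fun a ha => this ha
  have : Ideal.span (Set.range (T k (n := n))) = RingHom.ker χ := by
    refine le_antisymm hχ fun a ha => ?_
    obtain ⟨r, hr⟩ := exists_sub_mem_span k a
    have h := hχ _ hr
    rw [map_sub, RingHom.mem_ker.1 ha, AlgHom.commutes, zero_sub, neg_eq_zero] at h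
    rw [show r = 0 from h, map_zero, sub_zero] at hr
    exact hr
  rw [this]
  exact RingHom.ker_isMaximal_of_surjective χ fun r => ⟨algebraMap k _ r, χ.commutes r⟩

instance isLocalRing : IsLocalRing (RadSquareZeroAlgebra k n) := by
  refine IsLocalRing.of_unique_max_ideal ⟨_, isMaximal_span k, fun I hI => ?_⟩
  refine ((isMaximal_span k).eq_of_le hI.ne_top ?_).symm
  -- An ideal of square zero lies in every prime ideal, hence in every maximal one.
  refine (Ideal.IsPrime.mul_le hI.isPrime).1 ?_ |>.elim id id
  rw [span_mul_span]
  exact bot_le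

theorem jacobson_eq :
    Ring.jacobson (RadSquareZeroAlgebra k n) = Ideal.span (Set.range (T k)) := by
  rw [IsLocalRing.ringJacobson_eq_maximalIdeal]
  exact (IsLocalRing.eq_maximalIdeal (isMaximal_span k)).symm

theorem jacobson_sq : Ring.jacobson (RadSquareZeroAlgebra k n) ^ 2 = ⊥ := by
  rw [jacobson_eq]
  exact (pow_two _).trans (span_mul_span k)

/-! ### Socle, radical, and chains of lines. -/

section Modules

variable {k} {M : Type*} [AddCommGroup M] [Module (RadSquareZeroAlgebra k n) M]

theorem T_smul_mem_jacobson (j : Fin n) (m : M) :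
    T k j • m ∈ Module.jacobson (RadSquareZeroAlgebra k n) M := by
  refine Ring.jacobson_smul_top_le _ _ (Submodule.smul_mem_smul ?_ trivial)
  rw [jacobson_eq]
  exact Ideal.subset_span ⟨j, rfl⟩

variable [Module k M] [IsScalarTower k (RadSquareZeroAlgebra k n) M]

theorem exists_smul_eq (a : RadSquareZeroAlgebra k n) :
    ∃ (r : k) (c : Fin n → k), ∀ m : M, a • m = r • m + ∑ j, c j • T k j • m := by
  obtain ⟨r, c, rfl⟩ := exists_eq k a
  refine ⟨r, c, fun m => ?_⟩
  rw [add_smul, algebraMap_smul, Finset.sum_smul]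
  simp only [smul_assoc]

/-- A subspace which is stable under the generators is a submodule. -/
def submoduleOfStable (Q : Submodule k M) (h : ∀ j : Fin n, ∀ m ∈ Q, T k j • m ∈ Q) :
    Submodule (RadSquareZeroAlgebra k n) M :=
  { Q with
    smul_mem' := fun a m hm => by
      obtain ⟨r, c, hrc⟩ := exists_smul_eq (M := M) a
      rw [hrc]
      exact Q.add_mem (Q.smul_mem r hm) (Q.sum_mem fun j _ => Q.smul_mem _ (h j m hm)) }

/-- The radical annihilates simple modules. Conversely, on a vector killed by the generators the
algebra acts by scalars, so the line it spans is a simple submodule. -/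
theorem mem_moduleSocle_iff {m : M} :
    m ∈ moduleSocle (RadSquareZeroAlgebra k n) M ↔ ∀ j : Fin n, T k j • m = 0 := by
  constructor
  · intro hm j
    let K : Submodule (RadSquareZeroAlgebra k n) M :=
      LinearMap.ker (LinearMap.lsmul (RadSquareZeroAlgebra k n) M (T k j))
    have hK : moduleSocle (RadSquareZeroAlgebra k n) M ≤ K := by
      refine sSup_le fun S (hS : IsSimpleModule _ S) s hs => ?_
      have hann := IsSemisimpleModule.jacobson_le_annihilator (RadSquareZeroAlgebra k n) S
      rw [jacobson_eq] at hann
      have := Module.mem_annihilator.1 (hann (Ideal.subset_span ⟨j, rfl⟩)) ⟨s, hs⟩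
      exact congrArg Subtype.val this
    exact hK hm
  · intro hm
    by_cases h0 : m = 0
    · rw [h0]; exact zero_mem _
    have hsmul : ∀ a : RadSquareZeroAlgebra k n, ∃ r : k, a • m = r • m := by
      intro a
      obtain ⟨r, c, hrc⟩ := exists_smul_eq (M := M) a
      exact ⟨r, by simp [hrc, hm]⟩
    have hsimple : IsSimpleModule (RadSquareZeroAlgebra k n)
        (Submodule.span (RadSquareZeroAlgebra k n) {m}) := by
      rw [isSimpleModule_iff_isAtom]
      refine ⟨fun h => h0 (Submodule.span_singleton_eq_bot.1 h), fun N hN => ?_⟩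
      by_contra hne
      obtain ⟨z, hz, hz0⟩ := Submodule.exists_mem_ne_zero_of_ne_bot hne
      obtain ⟨a, rfl⟩ := Submodule.mem_span_singleton.1 (hN.le hz)
      obtain ⟨r, hr⟩ := hsmul a
      rw [hr] at hz hz0
      have hr0 : r ≠ 0 := fun h => hz0 (by rw [h, zero_smul])
      refine not_le_of_gt hN ((Submodule.span_singleton_le_iff_mem _ _).2 ?_)
      have := N.smul_mem (algebraMap k _ r⁻¹) hz
      rwa [algebraMap_smul, smul_smul, inv_mul_cancel₀ hr0, one_smul] at this
    exact (le_sSup hsimple : _ ≤ moduleSocle _ _) (Submodule.mem_span_singleton_self m)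

theorem isCoatom_of_ker (φ : M →ₗ[k] k) (hφ : φ ≠ 0)
    {H : Submodule (RadSquareZeroAlgebra k n) M} (hH : ∀ z, z ∈ H ↔ φ z = 0) : IsCoatom H := by
  refine ⟨fun h => hφ (LinearMap.ext fun m => (hH m).1 (h ▸ Submodule.mem_top)), fun K hK => ?_⟩
  obtain ⟨z, hzK, hzH⟩ := SetLike.exists_of_lt hK
  rw [hH] at hzH
  refine eq_top_iff.2 fun w _ => ?_
  have h1 : w - (φ w / φ z) • z ∈ K := hK.le ((hH _).2 (by simp [hzH]))
  have h2 : (φ w / φ z) • z ∈ K := (K.restrictScalars k).smul_mem _ hzK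
  simpa using add_mem h1 h2

/-- A vector outside `N` is separated from `N` by a linear form. Its kernel contains all `T_j M`, so
it is a submodule, and being a hyperplane it is maximal. -/
theorem jacobson_le_of_T_smul_mem (N : Submodule (RadSquareZeroAlgebra k n) M)
    (hN : ∀ (j : Fin n) (m : M), T k j • m ∈ N) :
    Module.jacobson (RadSquareZeroAlgebra k n) M ≤ N := by
  intro m hm
  by_contra hmN
  obtain ⟨φ, hφm, hφN⟩ := Submodule.exists_le_ker_of_notMem (p := N.restrictScalars k) hmN
  have hco := isCoatom_of_ker φ (fun h => hφm (by rw [h]; rfl))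
    (H := submoduleOfStable (n := n) (LinearMap.ker φ) fun j z _ => hφN (hN j z)) fun z => Iff.rfl
  exact hφm (Submodule.mem_sInf.1 hm _ hco)

theorem jacobson_le_moduleSocle : Module.jacobson (RadSquareZeroAlgebra k n) M ≤
    moduleSocle (RadSquareZeroAlgebra k n) M := by
  refine jacobson_le_of_T_smul_mem _ fun i m => mem_moduleSocle_iff.2 fun j => ?_
  rw [smul_smul, T_mul_T, zero_smul]

variable [FiniteDimensional k M] {i : ℕ}

/-- Two different points of a quiver Grassmannian are joined by a projective line as soon as the
radical maps both of them into their intersection. -/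
theorem exists_line [Infinite k] (U U' : QuiverGrassmannian k (RadSquareZeroAlgebra k n) M i)
    (hne : U ≠ U')
    (hU : ∀ j : Fin n, ∀ m ∈ U.toSubmodule, T k j • m ∈ U'.toSubmodule)
    (hU' : ∀ j : Fin n, ∀ m ∈ U'.toSubmodule, T k j • m ∈ U.toSubmodule) :
    ∃ f : ℙ k (Fin 2 → k) → QuiverGrassmannian k (RadSquareZeroAlgebra k n) M i,
      IsRationalCurve i QuiverGrassmannian.plucker f ∧
      IsProjectiveLineIn QuiverGrassmannian.plucker (Set.range f) ∧
      U ∈ Set.range f ∧ U' ∈ Set.range f := by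
  refine QuiverGrassmannian.exists_line U U' hne fun a => ?_
  obtain ⟨r, c, hrc⟩ := exists_smul_eq (M := M) a
  refine ⟨r, fun m hm => ?_⟩
  rw [hrc, add_sub_cancel_left]
  refine sum_mem fun j _ => ?_
  have h : T k j • m ∈ U.toSubmodule ⊓ U'.toSubmodule := by
    rcases hm with hm | hm
    · exact ⟨U.toSubmodule.smul_mem _ hm, hU j m hm⟩
    · exact ⟨hU' j m hm, U'.toSubmodule.smul_mem _ hm⟩
  exact ((U.toSubmodule ⊓ U'.toSubmodule).restrictScalars k).smul_mem _ h

/-- Choose `U'` of dimension `i` between `U ∩ soc M` and `soc M`. The radical maps `U` into `U ∩ rad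
M ⊆ U ∩ soc M ⊆ U'` and kills `U'`, so the criterion for lines applies. -/
theorem exists_line_socle [Infinite k]
    (hi : i ≤ Module.finrank k (moduleSocle (RadSquareZeroAlgebra k n) M))
    (U : QuiverGrassmannian k (RadSquareZeroAlgebra k n) M i)
    (hU : ¬ U.toSubmodule ≤ moduleSocle (RadSquareZeroAlgebra k n) M) :
    ∃ (U' : QuiverGrassmannian k (RadSquareZeroAlgebra k n) M i)
      (f : ℙ k (Fin 2 → k) → QuiverGrassmannian k (RadSquareZeroAlgebra k n) M i),
      U'.toSubmodule ≤ moduleSocle (RadSquareZeroAlgebra k n) M ∧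
      IsRationalCurve i QuiverGrassmannian.plucker f ∧
      IsProjectiveLineIn QuiverGrassmannian.plucker (Set.range f) ∧
      U ∈ Set.range f ∧ U' ∈ Set.range f := by
  let S := (moduleSocle (RadSquareZeroAlgebra k n) M).restrictScalars k
  let P := U.toSubmodule.restrictScalars k
  have hP : Module.finrank k P = i := U.finrank_eq
  obtain ⟨Q, hPQ, hQS, hQ⟩ := Submodule.exists_between_finrank (P ⊓ S) S inf_le_right
    ((Submodule.finrank_mono inf_le_left).trans hP.le) hi
  have hQ0 : ∀ j : Fin n, ∀ m ∈ Q, T k j • m = 0 := fun j m hm =>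
    mem_moduleSocle_iff.1 (hQS hm) j
  let U' : QuiverGrassmannian k (RadSquareZeroAlgebra k n) M i :=
    ⟨submoduleOfStable Q fun j m hm => by rw [hQ0 j m hm]; exact Q.zero_mem, hQ⟩
  obtain ⟨f, hf⟩ := exists_line U U' (fun h => hU (h ▸ hQS))
    (fun j m hm => hPQ ⟨U.toSubmodule.smul_mem _ hm,
      jacobson_le_moduleSocle (T_smul_mem_jacobson j m)⟩)
    (fun j m hm => by rw [hQ0 j m hm]; exact U.toSubmodule.zero_mem)
  exact ⟨U', f, hQS, hf⟩

/-- Choose `U'` of dimension `i` between `rad M` and `U + rad M`; there is room since `rad M ⊆ soc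
M`. The radical maps `U` into `rad M ⊆ U'`, and it kills `rad M`, so it maps `U'` into `U`. -/
theorem exists_line_jacobson [Infinite k]
    (hi : Module.finrank k (moduleSocle (RadSquareZeroAlgebra k n) M) < i)
    (U : QuiverGrassmannian k (RadSquareZeroAlgebra k n) M i)
    (hU : ¬ Module.jacobson (RadSquareZeroAlgebra k n) M ≤ U.toSubmodule) :
    ∃ (U' : QuiverGrassmannian k (RadSquareZeroAlgebra k n) M i)
      (f : ℙ k (Fin 2 → k) → QuiverGrassmannian k (RadSquareZeroAlgebra k n) M i),
      Module.jacobson (RadSquareZeroAlgebra k n) M ≤ U'.toSubmodule ∧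
      IsRationalCurve i QuiverGrassmannian.plucker f ∧
      IsProjectiveLineIn QuiverGrassmannian.plucker (Set.range f) ∧
      U ∈ Set.range f ∧ U' ∈ Set.range f := by
  let R := (Module.jacobson (RadSquareZeroAlgebra k n) M).restrictScalars k
  let P := U.toSubmodule.restrictScalars k
  have hP : Module.finrank k P = i := U.finrank_eq
  have hR : Module.finrank k R ≤ i := (Submodule.finrank_mono
    (show R ≤ (moduleSocle (RadSquareZeroAlgebra k n) M).restrictScalars k from
      jacobson_le_moduleSocle)).trans hi.le
  obtain ⟨Q, hRQ, hQP, hQ⟩ := Submodule.exists_between_finrank R (P ⊔ R) le_sup_right hR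
    (hP.symm.le.trans (Submodule.finrank_mono le_sup_left))
  let U' : QuiverGrassmannian k (RadSquareZeroAlgebra k n) M i :=
    ⟨submoduleOfStable Q fun j m _ => hRQ (T_smul_mem_jacobson j m), hQ⟩
  obtain ⟨f, hf⟩ := exists_line U U' (fun h => hU (h ▸ hRQ))
    (fun j m _ => hRQ (T_smul_mem_jacobson j m))
    (fun j m hm => by
      obtain ⟨p, hp, r, hr, rfl⟩ := Submodule.mem_sup.1 (hQP hm)
      rw [smul_add, mem_moduleSocle_iff.1 (jacobson_le_moduleSocle hr) j, add_zero]
      exact U.toSubmodule.smul_mem _ hp)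
  exact ⟨U', f, hRQ, hf⟩

theorem nonempty_quiverGrassmannian (hi : i ≤ Module.finrank k M) :
    Nonempty (QuiverGrassmannian k (RadSquareZeroAlgebra k n) M i) := by
  let R := (Module.jacobson (RadSquareZeroAlgebra k n) M).restrictScalars k
  let S := (moduleSocle (RadSquareZeroAlgebra k n) M).restrictScalars k
  have hRS : R ≤ S := jacobson_le_moduleSocle
  by_cases h : i ≤ Module.finrank k S
  · obtain ⟨Q, -, hQS, hQ⟩ := Submodule.exists_between_finrank ⊥ S bot_le (by simp) h
    exact ⟨⟨submoduleOfStable Q fun j m hm => by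
      rw [mem_moduleSocle_iff.1 (hQS hm) j]; exact Q.zero_mem, hQ⟩⟩
  · obtain ⟨Q, hRQ, -, hQ⟩ := Submodule.exists_between_finrank R ⊤ le_top
      ((Submodule.finrank_mono hRS).trans (not_le.1 h).le) (by simpa using hi)
    exact ⟨⟨submoduleOfStable Q fun j m _ => hRQ (T_smul_mem_jacobson j m), hQ⟩⟩

theorem isRationallyChainConnected [Infinite k] :
    IsRationallyChainConnected (QuiverGrassmannian.plucker
      (k := k) (A := RadSquareZeroAlgebra k n) (M := M) (i := i)) := by
  let joined (U V : QuiverGrassmannian k (RadSquareZeroAlgebra k n) M i) : Prop :=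
    ∃ f : ℙ k (Fin 2 → k) → QuiverGrassmannian k (RadSquareZeroAlgebra k n) M i,
      IsRationalCurve i QuiverGrassmannian.plucker f ∧ U ∈ Set.range f ∧ V ∈ Set.range f
  have hsymm : ∀ U V, joined U V → joined V U := fun U V ⟨f, hf, h1, h2⟩ => ⟨f, hf, h2, h1⟩
  have hrefl : ∀ U, joined U U := fun U => by
    have : Nonempty (ℙ k (Fin 2 → k)) :=
      ⟨Projectivization.mk k 1 one_ne_zero⟩
    exact ⟨_, isRationalCurve_const i _ U, ⟨Classical.arbitrary _, rfl⟩,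
      ⟨Classical.arbitrary _, rfl⟩⟩
  -- `G` singles out the points inside the socle when `i ≤ dim soc M`, and those containing the
  -- radical otherwise. Every point is joined to `G`, and points of `G` are joined to each other.
  obtain ⟨G, hG, hGG⟩ : ∃ G : QuiverGrassmannian k (RadSquareZeroAlgebra k n) M i → Prop,
      (∀ U, ∃ V, G V ∧ joined U V) ∧ ∀ U V, G U → G V → joined U V := by
    by_cases hi : i ≤ Module.finrank k (moduleSocle (RadSquareZeroAlgebra k n) M)
    · refine ⟨fun U => U.toSubmodule ≤ moduleSocle (RadSquareZeroAlgebra k n) M, ?_, ?_⟩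
      · intro U
        by_cases hU : U.toSubmodule ≤ moduleSocle (RadSquareZeroAlgebra k n) M
        · exact ⟨U, hU, hrefl U⟩
        · obtain ⟨V, f, hV, hf, -, h⟩ := exists_line_socle hi U hU
          exact ⟨V, hV, f, hf, h⟩
      · intro U V hU hV
        by_cases h : U = V
        · exact h ▸ hrefl U
        · obtain ⟨f, hf, -, h'⟩ := exists_line U V h
            (fun j m hm => by rw [mem_moduleSocle_iff.1 (hU hm) j]; exact zero_mem _)
            (fun j m hm => by rw [mem_moduleSocle_iff.1 (hV hm) j]; exact zero_mem _)
          exact ⟨f, hf, h'⟩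
    · refine ⟨fun U => Module.jacobson (RadSquareZeroAlgebra k n) M ≤ U.toSubmodule, ?_, ?_⟩
      · intro U
        by_cases hU : Module.jacobson (RadSquareZeroAlgebra k n) M ≤ U.toSubmodule
        · exact ⟨U, hU, hrefl U⟩
        · obtain ⟨V, f, hV, hf, -, h⟩ := exists_line_jacobson (not_le.1 hi) U hU
          exact ⟨V, hV, f, hf, h⟩
      · intro U V hU hV
        by_cases h : U = V
        · exact h ▸ hrefl U
        · obtain ⟨f, hf, -, h'⟩ := exists_line U V h
            (fun j m _ => hV (T_smul_mem_jacobson j m))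
            (fun j m _ => hU (T_smul_mem_jacobson j m))
          exact ⟨f, hf, h'⟩
  -- Every curve used has degree at most `i`, and the chain runs from `x` into `G`, within `G`, and
  -- back out to `y`.
  refine ⟨i, 3, fun x y => ?_⟩
  obtain ⟨x', hx', hxx'⟩ := hG x
  obtain ⟨y', hy', hyy'⟩ := hG y
  refine ⟨![x, x', y', y], rfl, rfl, fun j => ?_⟩
  have hj : joined ((![x, x', y', y] : Fin 4 → _) j.castSucc)
      ((![x, x', y', y] : Fin 4 → _) j.succ) := by
    fin_cases j
    · exact hxx'
    · exact hGG _ _ hx' hy'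
    · exact hsymm _ _ hyy'
  exact hj

theorem connectedSpace_quiverGrassmannian [Infinite k] (hi : i ≤ Module.finrank k M) :
    ConnectedSpace (QuiverGrassmannian k (RadSquareZeroAlgebra k n) M i) :=
  { (isRationallyChainConnected (k := k) (n := n) (M := M) (i := i)).preconnectedSpace with
    toNonempty := nonempty_quiverGrassmannian hi }

end Modules

end RadSquareZeroAlgebra

/-! ### Fermat curves contain no rational curves. -/

section Fermat

variable {k : Type*} [Field k]

theorem Polynomial.eq_C_mul_of_pow_eq {a b : Polynomial k} {m : ℕ} (hm : m ≠ 0)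
    (h : a ^ m ∣ b ^ m) (h' : b ^ m ∣ a ^ m) :
    ∃ (g : Polynomial k) (c d : k), a = C c * g ∧ b = C d * g := by
  have h1 := (UniqueFactorizationMonoid.pow_dvd_pow_iff_dvd hm).1 h
  have h2 := (UniqueFactorizationMonoid.pow_dvd_pow_iff_dvd hm).1 h'
  obtain ⟨u, hu⟩ := associated_of_dvd_dvd h1 h2
  obtain ⟨r, -, hr⟩ := Polynomial.isUnit_iff.1 u.isUnit
  exact ⟨a, 1, r, by simp, by rw [← hu, ← hr, mul_comm]⟩

/-- The polynomial solutions of the Fermat equation are proportional to constant solutions. -/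
theorem Polynomial.fermat_proportional {m : ℕ} (hm : 3 ≤ m) (hmk : (m : k) ≠ 0)
    (h : Fin 3 → Polynomial k) (heq : h 0 ^ m + h 1 ^ m = h 2 ^ m) :
    ∃ (g : Polynomial k) (c : Fin 3 → k), ∀ i, h i = C (c i) * g := by
  classical
  have hm0 : m ≠ 0 := by omega
  -- `Polynomial.flt` needs nonzero coprime entries. If one entry vanishes, the other two have equal
  -- powers up to sign and are proportional; otherwise the common divisor is removed first.
  by_cases h0 : h 0 = 0
  · rw [h0, zero_pow hm0, zero_add] at heq
    obtain ⟨g, c, d, hc, hd⟩ := eq_C_mul_of_pow_eq hm0 heq.dvd heq.symm.dvd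
    refine ⟨g, ![0, c, d], fun i => ?_⟩
    fin_cases i <;> simp [h0, hc, hd]
  by_cases h1 : h 1 = 0
  · rw [h1, zero_pow hm0, add_zero] at heq
    obtain ⟨g, c, d, hc, hd⟩ := eq_C_mul_of_pow_eq hm0 heq.dvd heq.symm.dvd
    refine ⟨g, ![c, 0, d], fun i => ?_⟩
    fin_cases i <;> simp [h1, hc, hd]
  by_cases h2 : h 2 = 0
  · rw [h2, zero_pow hm0] at heq
    have heq' : h 0 ^ m = -h 1 ^ m := eq_neg_of_add_eq_zero_left heq
    obtain ⟨g, c, d, hc, hd⟩ := eq_C_mul_of_pow_eq (a := h 0) (b := h 1) hm0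
      (by rw [heq']; exact (neg_dvd).2 dvd_rfl) (by rw [heq']; exact (dvd_neg).2 dvd_rfl)
    refine ⟨g, ![c, d, 0], fun i => ?_⟩
    fin_cases i <;> simp [h2, hc, hd]
  obtain ⟨a, ha⟩ := EuclideanDomain.gcd_dvd_left (h 0) (h 1)
  obtain ⟨b, hb⟩ := EuclideanDomain.gcd_dvd_right (h 0) (h 1)
  have hbez := EuclideanDomain.gcd_eq_gcd_ab (h 0) (h 1)
  set g := EuclideanDomain.gcd (h 0) (h 1) with hg
  have hg0 : g ≠ 0 := fun hg0 => h0 (by rw [ha, hg0, zero_mul])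
  have hcop : IsCoprime a b := by
    refine ⟨EuclideanDomain.gcdA (h 0) (h 1), EuclideanDomain.gcdB (h 0) (h 1),
      mul_left_cancel₀ hg0 ?_⟩
    conv_rhs => rw [mul_one, hbez]
    conv_rhs => enter [1, 1]; rw [ha]
    conv_rhs => enter [2, 1]; rw [hb]
    ring
  have hgc : g ∣ h 2 := by
    refine (UniqueFactorizationMonoid.pow_dvd_pow_iff_dvd hm0).1 ?_
    rw [← heq]
    exact dvd_add (pow_dvd_pow_of_dvd ⟨a, ha⟩ m) (pow_dvd_pow_of_dvd ⟨b, hb⟩ m)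
  obtain ⟨c, hc⟩ := hgc
  have heq' : a ^ m + b ^ m = c ^ m := by
    refine mul_left_cancel₀ (pow_ne_zero m hg0) ?_
    rw [mul_add, ← mul_pow, ← mul_pow, ← mul_pow, ← ha, ← hb, ← hc, heq]
  obtain ⟨da, db, dc⟩ := Polynomial.flt hm hmk (fun h => h0 (by rw [ha, h, mul_zero]))
    (fun h => h1 (by rw [hb, h, mul_zero])) (fun h => h2 (by rw [hc, h, mul_zero])) hcop heq'
  refine ⟨g, ![a.coeff 0, b.coeff 0, c.coeff 0], fun i => ?_⟩
  fin_cases i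
  · simp only [Fin.zero_eta, Matrix.cons_val_zero]
    rw [← Polynomial.eq_C_of_natDegree_eq_zero da, mul_comm]; exact ha
  · simp only [Fin.mk_one, Matrix.cons_val_one, Matrix.cons_val_zero]
    rw [← Polynomial.eq_C_of_natDegree_eq_zero db, mul_comm]; exact hb
  · simp only [Fin.reduceFinMk, Matrix.cons_val]
    rw [← Polynomial.eq_C_of_natDegree_eq_zero dc, mul_comm]; exact hc

/-- The Fermat curve of degree `m`. -/
def fermatCurve (k : Type*) [Field k] (m : ℕ) : Set (ℙ k (Fin 3 → k)) :=
  {x | x.rep 0 ^ m + x.rep 1 ^ m - x.rep 2 ^ m = 0}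

theorem isHomogeneousFun_coord {ι : Type*} (j : ι) :
    IsHomogeneousFun k 1 (fun w : ι → k => w j) :=
  IsHomogeneousFun.linear (LinearMap.proj (R := k) (φ := fun _ : ι => k) j)

theorem isHomogeneousFun_fermat (m : ℕ) :
    IsHomogeneousFun k (1 * m) (fun w : Fin 3 → k => w 0 ^ m + w 1 ^ m - w 2 ^ m) :=
  (((isHomogeneousFun_coord 0).pow m).add ((isHomogeneousFun_coord 1).pow m)).sub
    ((isHomogeneousFun_coord 2).pow m)

theorem isClosed_fermatCurve (m : ℕ) : IsClosed (fermatCurve k m) :=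
  (isHomogeneousFun_fermat m).isClosed

theorem mk_mem_fermatCurve {m : ℕ} {w : Fin 3 → k} (hw : w ≠ 0) :
    Projectivization.mk k w hw ∈ fermatCurve k m ↔ w 0 ^ m + w 1 ^ m - w 2 ^ m = 0 :=
  not_iff_not.1 ((isHomogeneousFun_fermat m).ne_zero_iff_of_mk_eq hw)

open MvPolynomial in
-- Eisenstein's criterion for a polynomial in the first variable, at the maximal ideal `P` of the
-- point `(1, 1)`. The constant term `X 0 ^ m - X 1 ^ m` vanishes there only to first order, because
-- its partial derivative takes the value `m ≠ 0`.
theorem irreducible_fermat {m : ℕ} (hmk : (m : k) ≠ 0) :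
    Irreducible (X 0 ^ m + X 1 ^ m - X 2 ^ m : MvPolynomial (Fin 3) k) := by
  have hm0 : m ≠ 0 := by rintro rfl; simp at hmk
  rw [← MulEquiv.irreducible_iff (finSuccEquiv k 2)]
  have hf : finSuccEquiv k 2 (X 0 ^ m + X 1 ^ m - X 2 ^ m) =
      Polynomial.X ^ m + Polynomial.C (X 0 ^ m - X 1 ^ m) := by
    have e1 : finSuccEquiv k 2 (X 1) = Polynomial.C (X 0) := finSuccEquiv_X_succ (j := 0)
    have e2 : finSuccEquiv k 2 (X 2) = Polynomial.C (X 1) := finSuccEquiv_X_succ (j := 1)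
    rw [map_sub, map_add, map_pow, map_pow, map_pow, e1, e2, finSuccEquiv_X_zero, map_sub, map_pow,
      map_pow]
    ring
  rw [hf]
  let P : Ideal (MvPolynomial (Fin 2) k) := RingHom.ker (eval (1 : Fin 2 → k))
  have hder : ∀ a ∈ P ^ 2, pderiv (0 : Fin 2) a ∈ P := by
    intro a ha
    rw [sq] at ha
    refine Submodule.mul_induction_on ha (fun x hx y hy => ?_) fun x y hx hy => ?_
    · rw [Derivation.leibniz]
      exact add_mem (Ideal.mul_mem_right _ P hx) (Ideal.mul_mem_right _ P hy)
    · rw [map_add]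
      exact add_mem hx hy
  have hmonic := Polynomial.monic_X_pow_add_C (X 0 ^ m - X 1 ^ m : MvPolynomial (Fin 2) k) hm0
  have hdeg := Polynomial.degree_X_pow_add_C (Nat.pos_of_ne_zero hm0)
    (X 0 ^ m - X 1 ^ m : MvPolynomial (Fin 2) k)
  refine Polynomial.irreducible_of_eisenstein_criterion (P := P) (RingHom.ker_isPrime _) ?_ ?_ ?_ ?_
    hmonic.isPrimitive
  · rw [hmonic.leadingCoeff]
    simp [P, RingHom.mem_ker]
  · intro j hj
    rw [hdeg, Nat.cast_lt] at hj
    rw [Polynomial.coeff_add, Polynomial.coeff_X_pow, if_neg hj.ne, zero_add, Polynomial.coeff_C]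
    split_ifs
    · simp [P, RingHom.mem_ker]
    · exact zero_mem _
  · rw [hdeg]
    exact_mod_cast Nat.pos_of_ne_zero hm0
  · intro h
    rw [Polynomial.coeff_add, Polynomial.coeff_X_pow, if_neg hm0.symm, zero_add,
      Polynomial.coeff_C_zero] at h
    have := hder _ h
    rw [RingHom.mem_ker] at this
    simp [Derivation.leibniz_pow, pderiv_X] at this
    exact hmk this

theorem IsHomogeneousFun.exists_mvPolynomial {σ : Type*} [Fintype σ] [DecidableEq σ] {d : ℕ}
    {f : (σ → k) → k} (hf : IsHomogeneousFun k d f) :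
    ∃ q : MvPolynomial σ k, ∀ w, MvPolynomial.eval w q = f w := by
  obtain ⟨p, -, hp⟩ := hf
  refine ⟨MvPolynomial.aeval (fun φ : Module.Dual k (σ → k) =>
    ∑ j, MvPolynomial.C (φ (Pi.single j 1)) * MvPolynomial.X j) p, fun w => ?_⟩
  have h : (MvPolynomial.eval w).comp (MvPolynomial.aeval (R := k)
      (fun φ : Module.Dual k (σ → k) =>
        ∑ j, MvPolynomial.C (φ (Pi.single j 1)) * MvPolynomial.X j)).toRingHom =
      MvPolynomial.eval (fun φ : Module.Dual k (σ → k) => φ w) := by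
    refine MvPolynomial.ringHom_ext (fun r => by simp) fun φ => ?_
    have : φ w = ∑ j, φ (Pi.single j 1) * w j := by
      conv_lhs => rw [pi_eq_sum_univ' w, map_sum]
      refine Finset.sum_congr rfl fun j _ => ?_
      rw [map_smul, smul_eq_mul, mul_comm]
    simp [this]
  exact (DFunLike.congr_fun h p).trans (hp w).symm

/-- If two basic open sets meet the curve in disjoint nonempty sets, the product of their equations
vanishes on the curve. By the Nullstellensatz the prime `F` divides one of the factors,
contradicting nonemptiness. -/
theorem isIrreducible_fermatCurve [IsAlgClosed k] {m : ℕ} (hmk : (m : k) ≠ 0) :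
    IsIrreducible (fermatCurve k m) := by
  have hm0 : m ≠ 0 := by rintro rfl; simp at hmk
  have h101 : (![1, 0, 1] : Fin 3 → k) ≠ 0 := fun h => one_ne_zero (congrFun h 0)
  refine ⟨⟨Projectivization.mk k _ h101, (mk_mem_fermatCurve _).2 (by simp [hm0])⟩, ?_⟩
  rintro O O' hO hO' ⟨x, hxV, hxO⟩ ⟨y, hyV, hyO⟩
  obtain ⟨d, f, hf, hfx, hfO⟩ := exists_basic_open hO hxO
  obtain ⟨e, g, hg, hgy, hgO⟩ := exists_basic_open hO' hyO
  obtain ⟨q, hq⟩ := hf.exists_mvPolynomial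
  obtain ⟨r, hr⟩ := hg.exists_mvPolynomial
  by_contra hempty
  have hp := (irreducible_fermat (k := k) hmk).prime
  set F : MvPolynomial (Fin 3) k :=
    MvPolynomial.X 0 ^ m + MvPolynomial.X 1 ^ m - MvPolynomial.X 2 ^ m with hF
  have hFe : ∀ w, MvPolynomial.eval w F = w 0 ^ m + w 1 ^ m - w 2 ^ m := fun w => by simp [hF]
  have hprime := (Ideal.span_singleton_prime hp.ne_zero).2 hp
  -- The affine cone contains the origin, where `q * r` need not vanish if its degree is zero; the
  -- extra factor `X 0` takes care of this point. `F` does not divide `X 0`, as the point `(1, 0,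
  -- 1)` shows.
  have hmem : MvPolynomial.X 0 * (q * r) ∈ Ideal.span {F} := by
    rw [← MvPolynomial.IsPrime.vanishingIdeal_zeroLocus (k := k) (K := k) (Ideal.span {F})]
    rw [MvPolynomial.mem_vanishingIdeal_iff]
    intro w hw
    have hFw : MvPolynomial.eval w F = 0 := hw F (Ideal.mem_span_singleton_self F)
    change MvPolynomial.eval w _ = 0
    rw [map_mul, map_mul, MvPolynomial.eval_X, hq, hr]
    by_cases hw0 : w = 0
    · simp [hw0]
    · have hwV : Projectivization.mk k w hw0 ∈ fermatCurve k m :=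
        (mk_mem_fermatCurve hw0).2 (by rw [← hFe, hFw])
      by_contra hne
      have hne' := right_ne_zero_of_mul hne
      exact hempty ⟨_, hwV,
        hfO ((hf.ne_zero_iff_of_mk_eq hw0).2 (left_ne_zero_of_mul hne')),
        hgO ((hg.ne_zero_iff_of_mk_eq hw0).2 (right_ne_zero_of_mul hne'))⟩
  rw [Ideal.mem_span_singleton] at hmem
  have heval : ∀ {s : MvPolynomial (Fin 3) k} {w : Fin 3 → k}, F ∣ s →
      w 0 ^ m + w 1 ^ m - w 2 ^ m = 0 → MvPolynomial.eval w s = 0 := by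
    rintro _ w ⟨s, rfl⟩ hw
    rw [map_mul, hFe, hw, zero_mul]
  rcases hp.dvd_or_dvd hmem with h | h
  · have := heval (w := ![1, 0, 1]) h (by simp [hm0])
    simp at this
  rcases hp.dvd_or_dvd h with h | h
  · exact hfx (by rw [← hq]; exact heval h hxV)
  · exact hgy (by rw [← hr]; exact heval h hyV)

/-- A map to the Fermat curve which is given by homogeneous polynomials on an open subset of a
projective space is constant there. -/
theorem eq_of_homogeneous_fermat [Infinite k] {W : Type*} [AddCommGroup W] [Module k W] {m : ℕ}
    (hm : 3 ≤ m) (hmk : (m : k) ≠ 0) {φ : ℙ k W → ℙ k (Fin 3 → k)}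
    (hφ : ∀ p, φ p ∈ fermatCurve k m) {O : Set (ℙ k W)} (hO : IsOpen O) {d : ℕ}
    {H : W → Fin 3 → k} (hH : IsHomogeneousMap k d H)
    (hφH : ∀ p ∈ O, ∃ h : H p.rep ≠ 0, φ p = Projectivization.mk k (H p.rep) h)
    {p q : ℙ k W} (hp : p ∈ O) (hq : q ∈ O) : φ p = φ q := by
  by_cases hpq : p = q
  · rw [hpq]
  obtain ⟨e, f, hf, hfp, hfO⟩ := exists_basic_open hO hp
  obtain ⟨P, hP⟩ := hf.exists_polynomial p.rep (q.rep - p.rep)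
  have hP0 : P ≠ 0 := by
    rintro rfl
    exact hfp (by simpa using (hP 0).symm)
  have hc : ∀ j, ∃ Q : Polynomial k, ∀ t : k, Q.eval t = H (p.rep + t • (q.rep - p.rep)) j :=
    fun j => (hH (LinearMap.proj (R := k) (φ := fun _ : Fin 3 => k) j)).exists_polynomial _ _
  choose h hh using hc
  have heq : h 0 ^ m + h 1 ^ m = h 2 ^ m := by
    rw [← sub_eq_zero]
    -- The Fermat equation is known only at parameters where `P` is nonzero. Multiplying by `P`
    -- makes it hold everywhere, and `P` is then cancelled.
    refine (mul_eq_zero.1 ?_ : P = 0 ∨ _).resolve_left hP0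
    refine Polynomial.funext fun t => ?_
    rw [Polynomial.eval_mul, Polynomial.eval_zero]
    by_cases hPt : P.eval t = 0
    · rw [hPt, zero_mul]
    have hw := Projectivization.rep_add_smul_sub_ne_zero hpq t
    rw [hP] at hPt
    obtain ⟨h1, h2⟩ := hφH _ (hfO ((hf.ne_zero_iff_of_mk_eq hw).2 hPt))
    obtain ⟨h3, h4⟩ := hH.mk_congr (Projectivization.rep_nonzero _)
      (Projectivization.mk_rep (Projectivization.mk k _ hw)) h1
    have h5 := hφ (Projectivization.mk k _ hw)
    rw [h2, h4, mk_mem_fermatCurve] at h5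
    simp only [Polynomial.eval_sub, Polynomial.eval_add, Polynomial.eval_pow, hh, h5, mul_zero]
  -- Along the line `H` equals `g` times a constant vector, so both endpoints have the same image.
  obtain ⟨g, c, hg⟩ := Polynomial.fermat_proportional hm hmk h heq
  obtain ⟨hp1, hp2⟩ := hφH p hp
  obtain ⟨hq1, hq2⟩ := hφH q hq
  rw [hp2, hq2]
  refine Projectivization.mk_eq_mk_of_cross _ _ fun i j => ?_
  have e0 : ∀ j, H p.rep j = c j * g.eval 0 := fun j => by
    have := hh j 0
    rw [hg] at this
    simpa using this.symm
  have e1 : ∀ j, H q.rep j = c j * g.eval 1 := fun j => by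
    have := hh j 1
    rw [hg] at this
    simpa using this.symm
  rw [e0, e1, e0, e1]
  ring

variable {E : Type*} [AddCommGroup E] [Module k E] {X : Type*} {ι : X → ℙ k E}

/-- Rationally chain connected projective algebraic sets have no nonconstant regular maps to
Fermat curves. -/
theorem IsRationallyChainConnected.eq_of_isRegularMap_fermat [Infinite k]
    (h : IsRationallyChainConnected ι) {m : ℕ} (hm : 3 ≤ m) (hmk : (m : k) ≠ 0)
    {e : X → fermatCurve k m}
    (he : IsRegularMap ι (fun x : fermatCurve k m => (x : ℙ k (Fin 3 → k))) e) (x y : X) :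
    e x = e y := by
  have hconst : ∀ (D : ℕ) (f : ℙ k (Fin 2 → k) → X), IsRationalCurve D ι f →
      ∀ p q, e (f p) = e (f q) := by
    intro D f hf
    have hcont := hf.continuous
    obtain ⟨d, -, F, hF, hfF⟩ := hf
    have hloc : ∀ p, ∃ O : Set (ℙ k (Fin 2 → k)), IsOpen O ∧ p ∈ O ∧
        ∀ q ∈ O, ∀ q' ∈ O, e (f q) = e (f q') := by
      intro p
      obtain ⟨O, d', G, hO, hpO, hG, hGe⟩ := he (f p)
      refine ⟨_, hO.preimage hcont, hpO, fun q hq q' hq' => Subtype.ext ?_⟩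
      refine eq_of_homogeneous_fermat hm hmk (φ := fun p => (e (f p) : ℙ k (Fin 3 → k)))
        (fun p => (e (f p)).2) (hO.preimage hcont) (hG.comp hF) (fun q hq => ?_) hq hq'
      obtain ⟨h1, h2⟩ := hGe (f q) hq
      obtain ⟨h3, h4⟩ := hfF q
      obtain ⟨h5, h6⟩ := hG.mk_congr (Projectivization.rep_nonzero _)
        ((Projectivization.mk_rep _).trans h4) h1
      exact ⟨h5, h2.trans h6⟩
    -- Neighbourhoods of `p` and `q` on which the map is constant meet, by irreducibility of `ℙ¹`.
    intro p q
    obtain ⟨O, hO, hpO, hOc⟩ := hloc p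
    obtain ⟨O', hO', hqO', hOc'⟩ := hloc q
    obtain ⟨r, hr, hr'⟩ := projectivization_inter_nonempty hO hO' ⟨p, hpO⟩ ⟨q, hqO'⟩
    exact (hOc p hpO r hr).trans (hOc' r hr' q hqO')
  obtain ⟨D, l, hc⟩ := h
  obtain ⟨c, rfl, rfl, hj⟩ := hc x y
  have key : ∀ j : Fin (l + 1), e (c 0) = e (c j) := by
    intro j
    induction j using Fin.induction with
    | zero => rfl
    | succ j ih =>
      obtain ⟨f, hf, ⟨a, ha⟩, ⟨b, hb⟩⟩ := hj j
      rw [ih, ← ha, ← hb]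
      exact hconst D f hf a b
  exact key _

/-- An isomorphism would be constant, but the points `[1 : 0 : 1]` and `[0 : 1 : 1]` of the curve
are distinct. -/
theorem IsRationallyChainConnected.not_isVarietyIso_fermat [Infinite k]
    (h : IsRationallyChainConnected ι) {m : ℕ} (hm : 3 ≤ m) (hmk : (m : k) ≠ 0)
    (e : X ≃ fermatCurve k m) :
    ¬ IsVarietyIso ι (fun x : fermatCurve k m => (x : ℙ k (Fin 3 → k))) e := by
  rintro ⟨he, -⟩
  have hm0 : m ≠ 0 := by omega
  have h101 : (![1, 0, 1] : Fin 3 → k) ≠ 0 := fun h => one_ne_zero (congrFun h 0)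
  have h011 : (![0, 1, 1] : Fin 3 → k) ≠ 0 := fun h => one_ne_zero (congrFun h 1)
  let a : fermatCurve k m :=
    ⟨Projectivization.mk k _ h101, (mk_mem_fermatCurve _).2 (by simp [hm0])⟩
  let b : fermatCurve k m :=
    ⟨Projectivization.mk k _ h011, (mk_mem_fermatCurve _).2 (by simp [hm0])⟩
  have hab := h.eq_of_isRegularMap_fermat hm hmk he (e.symm a) (e.symm b)
  rw [e.apply_symm_apply, e.apply_symm_apply] at hab
  obtain ⟨r, hr⟩ := (Projectivization.mk_eq_mk_iff' k _ _ _ _).1 (congrArg Subtype.val hab)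
  have := congrFun hr 0
  simp at this

variable (k) in
-- The exponent `3` works unless the characteristic is `3`, in which case `4 = 1` in `k`.
theorem exists_fermat_exponent : ∃ m : ℕ, 3 ≤ m ∧ (m : k) ≠ 0 := by
  by_cases h : ((3 : ℕ) : k) = 0
  · refine ⟨4, by norm_num, fun h4 => one_ne_zero (α := k) ?_⟩
    push_cast at h h4
    linear_combination h4 - h
  · exact ⟨3, le_rfl, h⟩

end Fermat

/-! ### Indecomposable summands and the radical of the module category. -/

section Indecomposable

variable {k : Type u} [Field k] {R : Type u} [Ring R] [Algebra k R]

/-- The idempotent endomorphisms of `X` with indecomposable image. -/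
def indecomposableIdempotents (X : FGModuleCat.{u} R) : Set (X ⟶ X) :=
  {h | ∃ (A : FGModuleCat.{u} R) (a : A ⟶ X) (p : X ⟶ A),
    IsIndecomposableModule A ∧ a ≫ p = 𝟙 A ∧ h = p ≫ a}

/-- Induction step for decompositions: an indecomposable summand of the summand `P` is one of `X`,
so a decomposition of the identity of `P` yields one of the projector `p ≫ a`. -/
theorem mem_closure_of_summand {X P : FGModuleCat.{u} R} (a : P ⟶ X) (p : X ⟶ P)
    (hap : a ≫ p = 𝟙 P) (hP : 𝟙 P ∈ AddSubgroup.closure (indecomposableIdempotents P)) :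
    p ≫ a ∈ AddSubgroup.closure (indecomposableIdempotents X) := by
  have key : ∀ h ∈ AddSubgroup.closure (indecomposableIdempotents P),
      p ≫ h ≫ a ∈ AddSubgroup.closure (indecomposableIdempotents X) := by
    intro h hh
    induction hh using AddSubgroup.closure_induction with
    | mem h hh =>
      obtain ⟨A, b, q, hA, hbq, rfl⟩ := hh
      exact AddSubgroup.subset_closure ⟨A, b ≫ a, p ≫ q, hA,
        by rw [Category.assoc, reassoc_of% hap, hbq], by simp⟩
    | zero => simp
    | add h h' _ _ ih ih' =>
      rw [Preadditive.add_comp, Preadditive.comp_add]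
      exact add_mem ih ih'
    | neg h _ ih =>
      rw [Preadditive.neg_comp, Preadditive.comp_neg]
      exact neg_mem ih
  simpa using key _ hP

theorem finite_of_finiteDimensional_algebra (M : Type*) [AddCommGroup M] [Module k M] [Module R M]
    [IsScalarTower k R M] [FiniteDimensional k M] : Module.Finite R M :=
  Module.Finite.of_restrictScalars_finite k R M

/-- Finite-dimensional modules are direct sums of indecomposable modules. -/
theorem id_mem_closure_indecomposableIdempotents (d : ℕ) : ∀ (M : Type u) [AddCommGroup M]
    [Module k M] [Module R M] [IsScalarTower k R M] [FiniteDimensional k M] [Module.Finite R M],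
    Module.finrank k M = d →
    𝟙 (FGModuleCat.of R M) ∈
      AddSubgroup.closure (indecomposableIdempotents (FGModuleCat.of R M)) := by
  induction d using Nat.strong_induction_on with
  | _ d ih =>
  intro M _ _ _ _ _ _ hd
  by_cases hind : IsIndecomposableModule (FGModuleCat.of R M)
  · exact AddSubgroup.subset_closure ⟨_, 𝟙 _, 𝟙 _, hind, by simp, by simp⟩
  by_cases hM : Nontrivial M
  · simp only [IsIndecomposableModule, not_and, not_forall, not_or] at hind
    obtain ⟨p, q, hpq, hp, hq⟩ := hind hM
    have hlt : ∀ p q : Submodule R M, IsCompl p q → q ≠ ⊥ → Module.finrank k p < d := by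
      intro p q hpq hq
      rw [← hd]
      refine Submodule.finrank_lt (K := k) (s := p.restrictScalars k) ?_
      intro h
      have hp : p = ⊤ := (Submodule.restrictScalars_eq_top_iff k R M).1 h
      rw [hp] at hpq
      exact hq (by simpa using hpq.inf_eq_bot)
    have hfin : ∀ p : Submodule R M, Module.Finite R p := fun p => by
      have : FiniteDimensional k p :=
        inferInstanceAs (FiniteDimensional k (p.restrictScalars k))
      exact finite_of_finiteDimensional_algebra (k := k) p
    have hsummand : ∀ (p q : Submodule R M) (hpq : IsCompl p q), q ≠ ⊥ →
        FGModuleCat.ofHom (p.subtype ∘ₗ p.projectionOnto q hpq) ∈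
          AddSubgroup.closure (indecomposableIdempotents (FGModuleCat.of R M)) := by
      intro p q hpq hq
      have := hfin p
      have : FiniteDimensional k p :=
        inferInstanceAs (FiniteDimensional k (p.restrictScalars k))
      refine mem_closure_of_summand (P := FGModuleCat.of R p) (FGModuleCat.ofHom p.subtype)
        (FGModuleCat.ofHom (p.projectionOnto q hpq)) ?_ (ih _ (hlt p q hpq hq) p rfl)
      ext x
      exact congrArg Subtype.val (Submodule.projectionOnto_apply_left hpq x)
    have hsum : 𝟙 (FGModuleCat.of R M) =
        FGModuleCat.ofHom (p.subtype ∘ₗ p.projectionOnto q hpq) +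
        FGModuleCat.ofHom (q.subtype ∘ₗ q.projectionOnto p hpq.symm) := by
      ext x
      exact (Submodule.projection_add_projection_eq_self hpq x).symm
    rw [hsum]
    exact add_mem (hsummand p q hpq hq) (hsummand q p hpq.symm hp)
  · have := not_nontrivial_iff_subsingleton.1 hM
    have h0 : 𝟙 (FGModuleCat.of R M) = 0 := by
      ext x
      exact Subsingleton.elim (α := M) _ _
    rw [h0]
    exact zero_mem _

/-- Composing with identity morphisms, which are sums of idempotents with indecomposable images,
reduces membership in the radical to maps between indecomposable direct summands. -/
theorem comp_mem_radHom {X Y Z : FGModuleCat.{u} R} (a : X ⟶ Z) (b : Z ⟶ Y)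
    (hX : 𝟙 X ∈ AddSubgroup.closure (indecomposableIdempotents X))
    (hZ : 𝟙 Z ∈ AddSubgroup.closure (indecomposableIdempotents Z))
    (h : ∀ (A : FGModuleCat.{u} R) (s : A ⟶ X) (p : X ⟶ A) (B : FGModuleCat.{u} R) (t : B ⟶ Z)
      (q : Z ⟶ B), IsIndecomposableModule A → IsIndecomposableModule B → s ≫ p = 𝟙 A →
      t ≫ q = 𝟙 B → ¬ IsIso (s ≫ a ≫ q)) :
    a ≫ b ∈ radHom X Y := by
  have key : ∀ e ∈ AddSubgroup.closure (indecomposableIdempotents X),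
      ∀ f ∈ AddSubgroup.closure (indecomposableIdempotents Z), e ≫ a ≫ f ≫ b ∈ radHom X Y := by
    intro e he f hf
    induction he using AddSubgroup.closure_induction with
    | mem e he =>
      obtain ⟨A, s, p, hA, hsp, rfl⟩ := he
      induction hf using AddSubgroup.closure_induction with
      | mem f hf =>
        obtain ⟨B, t, q, hB, htq, rfl⟩ := hf
        exact AddSubgroup.subset_closure ⟨A, B, p, s ≫ a ≫ q, t ≫ b, hA, hB,
          h A s p B t q hA hB hsp htq, by simp⟩
      | zero => simp
      | add f f' _ _ h1 h2 =>
        rw [Preadditive.add_comp, Preadditive.comp_add, Preadditive.comp_add]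
        exact add_mem h1 h2
      | neg f _ h1 =>
        rw [Preadditive.neg_comp, Preadditive.comp_neg, Preadditive.comp_neg]
        exact neg_mem h1
    | zero => simp
    | add e e' _ _ h1 h2 =>
      rw [Preadditive.add_comp]
      exact add_mem h1 h2
    | neg e _ h1 =>
      rw [Preadditive.neg_comp]
      exact neg_mem h1
  simpa using key _ hX _ hZ

end Indecomposable

/-! ### From `B`-modules to modules over the local algebra. -/

namespace RadSquareZeroAlgebra

section OfOperators

variable {k : Type u} [Field k] {n : ℕ} {V : Type*} [AddCommGroup V] [Module k V]

/-- The representation given by operators whose products vanish. -/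
noncomputable def representation (D : Fin n → Module.End k V) (hD : ∀ i j, D i * D j = 0) :
    RadSquareZeroAlgebra k n →ₐ[k] Module.End k V :=
  (TrivSqZeroExt.liftEquivOfComm ⟨Fintype.linearCombination k D, fun x y => by
    simp [Fintype.linearCombination_apply, Finset.sum_mul_sum, hD]⟩).comp (toTrivSqZeroExt k n)

theorem representation_T (D : Fin n → Module.End k V) (hD : ∀ i j, D i * D j = 0) (j : Fin n) :
    representation D hD (T k j) = D j := by
  rw [representation, AlgHom.comp_apply, toTrivSqZeroExt_T]
  simp [TrivSqZeroExt.liftEquivOfComm]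

end OfOperators

section LinearMaps

variable {k : Type u} [Field k] {n : ℕ} {M N : Type*} [AddCommGroup M] [Module k M]
  [Module (RadSquareZeroAlgebra k n) M] [IsScalarTower k (RadSquareZeroAlgebra k n) M]
  [AddCommGroup N] [Module k N]
  [Module (RadSquareZeroAlgebra k n) N] [IsScalarTower k (RadSquareZeroAlgebra k n) N]

/-- A linear map which commutes with the generators is a module homomorphism. -/
def linearMapOfCommute (g : M →ₗ[k] N) (h : ∀ (j : Fin n) m, g (T k j • m) = T k j • g m) :
    M →ₗ[RadSquareZeroAlgebra k n] N :=
  { g with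
    map_smul' := fun a m => by
      obtain ⟨r, c, rfl⟩ := exists_eq k a
      simp [add_smul, Finset.sum_smul, h] }

end LinearMaps

section Wild

variable {k : Type u} [Field k] {B : Type u} [Ring B] [Algebra k B] {m : ℕ}

/-- The operators on `X ^ (m + 1)` whose endomorphism ring is that of the `B`-module `X`: the
identity, a diagonal matrix with scalar entries, and a matrix with entries `1` in the first row
and the elements `b j` on the diagonal. -/
def wildOperator (b : Fin m → B) (c : Fin (m + 1) → k) (X : Type*) [AddCommGroup X] [Module k X]
    [Module B X] [IsScalarTower k B X] : ℕ → Module.End k (Fin (m + 1) → X)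
  | 0 => LinearMap.id
  | 1 => LinearMap.pi fun j => c j • LinearMap.proj j
  | 2 => LinearMap.pi (Fin.cons (∑ j, LinearMap.proj j)
      fun j => Algebra.lsmul k k X (b j) ∘ₗ LinearMap.proj j.succ)
  | _ => 0

/-- The module attached to the `B`-module `X`: two copies of `X ^ (m + 1)`, the generators acting
as maps from the first to the second copy. -/
def WildModule (_ : ℕ) (_ : Fin m → B) (_ : Fin (m + 1) → k) (X : Type u) : Type u :=
  (Fin (m + 1) → X) × (Fin (m + 1) → X)

variable {n : ℕ} {b : Fin m → B} {c : Fin (m + 1) → k}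
variable {X : Type u} [AddCommGroup X] [Module k X] [Module B X] [IsScalarTower k B X]
variable {Y : Type u} [AddCommGroup Y] [Module k Y] [Module B Y] [IsScalarTower k B Y]

namespace WildModule

instance : AddCommGroup (WildModule n b c X) :=
  inferInstanceAs (AddCommGroup ((Fin (m + 1) → X) × (Fin (m + 1) → X)))

instance : Module k (WildModule n b c X) :=
  inferInstanceAs (Module k ((Fin (m + 1) → X) × (Fin (m + 1) → X)))

instance [FiniteDimensional k X] : FiniteDimensional k (WildModule n b c X) :=
  inferInstanceAs (FiniteDimensional k ((Fin (m + 1) → X) × (Fin (m + 1) → X)))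

variable (n b c X) in
/-- The action of the generators. -/
def operator (j : Fin n) : Module.End k (WildModule n b c X) :=
  LinearMap.inr k (Fin (m + 1) → X) (Fin (m + 1) → X) ∘ₗ wildOperator b c X j ∘ₗ
    LinearMap.fst k (Fin (m + 1) → X) (Fin (m + 1) → X)

theorem operator_mul (i j : Fin n) : operator n b c X i * operator n b c X j = 0 := by
  refine LinearMap.ext fun w => ?_
  exact Prod.ext rfl (map_zero (wildOperator b c X i))

noncomputable instance : Module (RadSquareZeroAlgebra k n) (WildModule n b c X) :=
  Module.compHom _ (representation (operator n b c X) operator_mul).toRingHom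

theorem smul_def (a : RadSquareZeroAlgebra k n) (w : WildModule n b c X) :
    a • w = representation (operator n b c X) operator_mul a w := rfl

instance : IsScalarTower k (RadSquareZeroAlgebra k n) (WildModule n b c X) :=
  ⟨fun r a w => by rw [smul_def, smul_def, map_smul]; rfl⟩

instance [FiniteDimensional k X] : Module.Finite (RadSquareZeroAlgebra k n) (WildModule n b c X) :=
  finite_of_finiteDimensional_algebra (k := k) _

theorem T_smul (j : Fin n) (w : WildModule n b c X) :
    T k j • w = ((0, wildOperator b c X j w.1) : (Fin (m + 1) → X) × (Fin (m + 1) → X)) := by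
  rw [smul_def, representation_T]
  rfl

/-- The action of the functor `WildModule` on morphisms, as a linear map. -/
def linearMap (φ : X →ₗ[k] Y) : WildModule n b c X →ₗ[k] WildModule n b c Y :=
  LinearMap.prodMap (φ.compLeft (Fin (m + 1))) (φ.compLeft (Fin (m + 1)))

/-- The action of the functor `WildModule` on morphisms. -/
noncomputable def map (φ : X →ₗ[B] Y) :
    WildModule n b c X →ₗ[RadSquareZeroAlgebra k n] WildModule n b c Y :=
  linearMapOfCommute (linearMap (φ.restrictScalars k)) (by
    intro j w
    rw [T_smul, T_smul]
    refine Prod.ext (map_zero ((φ.restrictScalars k).compLeft (Fin (m + 1)))) ?_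
    funext i
    obtain ⟨j, hj⟩ := j
    match j with
    | 0 => rfl
    | 1 => exact map_smul (φ.restrictScalars k) _ _
    | 2 =>
      refine Fin.cases ?_ (fun i => ?_) i
      · change φ (((∑ j, LinearMap.proj j : (Fin (m + 1) → X) →ₗ[k] X)) w.1) =
          ((∑ j, LinearMap.proj j : (Fin (m + 1) → Y) →ₗ[k] Y)) fun j => φ (w.1 j)
        simp
      · exact map_smul φ _ _
    | (j + 3) => exact map_zero φ)

theorem exact_map {Z : Type u} [AddCommGroup Z] [Module k Z] [Module B Z] [IsScalarTower k B Z]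
    {φ : X →ₗ[B] Y} {ψ : Y →ₗ[B] Z} (h : Function.Exact φ ψ) :
    Function.Exact (map φ : WildModule n b c X →ₗ[_] _)
      (map ψ : WildModule n b c Y →ₗ[RadSquareZeroAlgebra k n] WildModule n b c Z) := by
  intro w
  constructor
  · intro hw
    have h1 : ∀ j, ψ (w.1 j) = 0 := fun j => congrFun (congrArg Prod.fst hw) j
    have h2 : ∀ j, ψ (w.2 j) = 0 := fun j => congrFun (congrArg Prod.snd hw) j
    choose u hu using fun j => (h _).1 (h1 j)
    choose v hv using fun j => (h _).1 (h2 j)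
    exact ⟨(u, v), Prod.ext (funext hu) (funext hv)⟩
  · rintro ⟨v, rfl⟩
    exact Prod.ext (funext fun j => h.apply_apply_eq_zero _)
      (funext fun j => h.apply_apply_eq_zero _)

/-- Maps commuting with the operators are induced from homomorphisms of `B`-modules. -/
theorem exists_of_commute (hc : Function.Injective c) (hb : Submodule.span k (Set.range b) = ⊤)
    (f : (Fin (m + 1) → X) →ₗ[k] (Fin (m + 1) → Y))
    (h1 : ∀ u, f (wildOperator b c X 1 u) = wildOperator b c Y 1 (f u))
    (h2 : ∀ u, f (wildOperator b c X 2 u) = wildOperator b c Y 2 (f u)) :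
    ∃ φ : X →ₗ[B] Y, ∀ u j, f u j = φ (u j) := by
  let φ (j : Fin (m + 1)) : X →ₗ[k] Y :=
    LinearMap.proj j ∘ₗ f ∘ₗ LinearMap.single k (fun _ => X) j
  -- Commuting with a diagonal matrix of distinct scalars forces `f` to be diagonal.
  have hdiag : ∀ j x, f (Pi.single j x) = Pi.single j (φ j x) := by
    intro j x
    funext i
    by_cases hij : i = j
    · subst hij
      simp [φ]
    · have e : wildOperator b c X 1 (Pi.single j x) = c j • Pi.single j x := by
        funext l
        by_cases hl : l = j
        · subst hl; simp [wildOperator]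
        · simp [wildOperator, hl]
      have := congrFun (h1 (Pi.single j x)) i
      rw [e, map_smul] at this
      have h3 : c j • f (Pi.single j x) i = c i • f (Pi.single j x) i := this
      rw [← sub_eq_zero, ← sub_smul, smul_eq_zero, sub_eq_zero] at h3
      rw [Pi.single_eq_of_ne hij]
      exact h3.resolve_left fun h => hij (hc h).symm
  have e0 : ∀ (Z : Type u) [AddCommGroup Z] [Module k Z] [Module B Z] [IsScalarTower k B Z]
      (j : Fin m) (x : Z), wildOperator b c Z 2 (Pi.single j.succ x) =
        Pi.single 0 x + Pi.single j.succ (b j • x) := by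
    intro Z _ _ _ _ j x
    funext l
    refine Fin.cases ?_ (fun l => ?_) l
    · simp [wildOperator]
    · by_cases hl : l = j
      · subst hl; simp [wildOperator]
      · simp [wildOperator, hl]
  -- Compare entries of the image of a vector in column `j + 1`: row `0` of the operator makes the
  -- diagonal entries of `f` equal, and row `j + 1` makes them commute with `b j`.
  have hφ : ∀ (j : Fin m) (x : X), φ 0 x = φ j.succ x ∧ φ j.succ (b j • x) = b j • φ j.succ x := by
    intro j x
    have := h2 (Pi.single j.succ x)
    rw [e0, map_add, hdiag, hdiag, hdiag, e0] at this
    refine ⟨by simpa using congrFun this 0, by simpa using congrFun this j.succ⟩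
  have hφb : ∀ (β : B) (x : X), φ 0 (β • x) = β • φ 0 x := by
    intro β x
    have hβ : β ∈ Submodule.span k (Set.range b) := hb ▸ Submodule.mem_top
    induction hβ using Submodule.span_induction with
    | mem β hβ =>
      obtain ⟨j, rfl⟩ := hβ
      rw [(hφ j _).1, (hφ j x).2, (hφ j x).1]
    | zero => simp
    | add β γ _ _ h h' => rw [add_smul, map_add, h, h', add_smul]
    | smul r β _ h => rw [smul_assoc, map_smul, h, smul_assoc]
  refine ⟨{ φ 0 with map_smul' := hφb }, fun u j => ?_⟩
  have hj : ∀ l, φ l = φ 0 := fun l => LinearMap.ext fun x =>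
    Fin.cases rfl (fun l => ((hφ l x).1).symm) l
  have : f u = fun l => φ l (u l) := by
    conv_lhs => rw [← Finset.univ_sum_single u, map_sum]
    simp only [hdiag]
    exact Finset.univ_sum_single fun l => φ l (u l)
  rw [this]
  simp only [hj]
  rfl

theorem T_zero_smul (hn : 0 < n) (w : WildModule n b c X) :
    T k (⟨0, hn⟩ : Fin n) • w =
      ((0, w.1) : (Fin (m + 1) → X) × (Fin (m + 1) → X)) :=
  T_smul _ w

/-- Every homomorphism is a sum of one induced from a homomorphism of `B`-modules and one with
vanishing first component. -/
theorem exists_map_sub (hn : 3 ≤ n) (hc : Function.Injective c) (hb : Submodule.span k (Set.range b) = ⊤)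
    (f : WildModule n b c X →ₗ[RadSquareZeroAlgebra k n] WildModule n b c Y) :
    ∃ φ : X →ₗ[B] Y, ∀ w, (f w - map φ w).1 = 0 := by
  let inl : (Fin (m + 1) → X) →ₗ[k] WildModule n b c X :=
    LinearMap.inl k (Fin (m + 1) → X) (Fin (m + 1) → X)
  let inr : (Fin (m + 1) → X) →ₗ[k] WildModule n b c X :=
    LinearMap.inr k (Fin (m + 1) → X) (Fin (m + 1) → X)
  let fst : WildModule n b c Y →ₗ[k] (Fin (m + 1) → Y) :=
    LinearMap.fst k (Fin (m + 1) → Y) (Fin (m + 1) → Y)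
  let g : (Fin (m + 1) → X) →ₗ[k] (Fin (m + 1) → Y) := fst ∘ₗ f.restrictScalars k ∘ₗ inl
  have hT : ∀ (j : Fin n) u, f (inr (wildOperator b c X j u)) =
      ((0, wildOperator b c Y j (g u)) : (Fin (m + 1) → Y) × (Fin (m + 1) → Y)) := by
    intro j u
    have e1 : inr (wildOperator b c X j u) = T k j • inl u := (T_smul j (inl u)).symm
    rw [e1, map_smul, T_smul]
    rfl
  have h0 : 0 < n := by omega
  -- The generator of index `0` identifies the first copy with the second, so `f` acts on the second
  -- copy by the same `g`. The other generators then force `g` to commute with the remaining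
  -- operators.
  have hinr : ∀ u, f (inr u) = ((0, g u) : (Fin (m + 1) → Y) × (Fin (m + 1) → Y)) :=
    fun u => hT ⟨0, h0⟩ u
  have hcomm : ∀ (j : Fin n) u, g (wildOperator b c X j u) = wildOperator b c Y j (g u) := by
    intro j u
    have := hT j u
    rw [hinr] at this
    exact congrArg Prod.snd this
  obtain ⟨φ, hφ⟩ := exists_of_commute hc hb g (hcomm ⟨1, by omega⟩) (hcomm ⟨2, by omega⟩)
  refine ⟨φ, fun w => ?_⟩
  have hw : w = inl w.1 + inr w.2 := Prod.ext (add_zero _).symm (zero_add _).symm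
  have h1 : fst (f w) = g w.1 := by
    conv_lhs => rw [hw, map_add, map_add, hinr]
    exact add_zero _
  change fst (f w) - (fun j => φ (w.1 j)) = 0
  rw [h1, sub_eq_zero]
  exact funext fun j => hφ _ j

end WildModule

end Wild

end RadSquareZeroAlgebra

/-! ### Controlled wildness, with the semisimple modules as control class. -/

namespace RadSquareZeroAlgebra

section ControlledWild

variable {k : Type u} [Field k] {n : ℕ}

variable (k n) in
/-- The modules which are annihilated by the radical. -/
def semisimpleModules : ObjectProperty (FGModuleCat.{u} (RadSquareZeroAlgebra k n)) :=
  fun Z => ∀ (j : Fin n) (z : Z), T k j • z = 0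

theorem T_smul_eq_zero_of_addClosure {Z : FGModuleCat.{u} (RadSquareZeroAlgebra k n)}
    (hZ : addClosure (semisimpleModules k n) Z) (j : Fin n) (z : Z) : T k j • z = 0 := by
  obtain ⟨J, _, Z', hZ', s, r, hrs⟩ := hZ
  have hs : T k j • s z = 0 := funext fun i => hZ' i j (s z i)
  have hz : r (s z) = z := LinearMap.congr_fun hrs z
  rw [← hz, ← map_smul, hs, map_zero]

variable {B : Type u} [Ring B] [Algebra k B] {m : ℕ} {b : Fin m → B} {c : Fin (m + 1) → k}
variable {X : Type u} [AddCommGroup X] [Module k X] [Module B X] [IsScalarTower k B X]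
  [FiniteDimensional k X]
variable {Y : Type u} [AddCommGroup Y] [Module k Y] [Module B Y] [IsScalarTower k B Y]
  [FiniteDimensional k Y]

/-- The maps which factor through semisimple modules are those with vanishing first component. -/
theorem WildModule.mem_homThrough_iff (hn : 0 < n)
    (f : FGModuleCat.of (RadSquareZeroAlgebra k n) (WildModule n b c X) ⟶
      FGModuleCat.of (RadSquareZeroAlgebra k n) (WildModule n b c Y)) :
    f ∈ homThrough (semisimpleModules k n) _ _ ↔
      ∀ w : WildModule n b c X, (f.hom.hom w : WildModule n b c Y).1 = 0 := by
  constructor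
  · rintro ⟨Z, hZ, p, q, rfl⟩ w
    have h1 : T k (⟨0, hn⟩ : Fin n) • (q.hom.hom (p.hom.hom w) : WildModule n b c Y) = 0 := by
      have := T_smul_eq_zero_of_addClosure hZ ⟨0, hn⟩ (p.hom.hom w)
      have h2 := congrArg q.hom.hom this
      rw [map_smul, map_zero] at h2
      exact h2
    rw [WildModule.T_zero_smul] at h1
    exact congrArg Prod.snd h1
  · intro hf
    -- The image of such a map lies in the second copy, which all generators annihilate; so the map
    -- factors through its own semisimple image.
    let g : WildModule n b c X →ₗ[RadSquareZeroAlgebra k n] WildModule n b c Y := f.hom.hom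
    have hfin : Module.Finite (RadSquareZeroAlgebra k n) (LinearMap.range g) :=
      Module.Finite.range g
    refine ⟨FGModuleCat.of _ (LinearMap.range g), ?_, FGModuleCat.ofHom g.rangeRestrict,
      FGModuleCat.ofHom (LinearMap.range g).subtype, rfl⟩
    refine ⟨Unit, inferInstance, fun _ => FGModuleCat.of _ (LinearMap.range g), ?_,
      LinearMap.pi fun _ => LinearMap.id, LinearMap.proj (), rfl⟩
    rintro - j ⟨_, w, rfl⟩
    refine Subtype.ext ?_
    change T k j • g w = 0
    rw [WildModule.T_smul]
    exact Prod.ext rfl (by rw [hf w, map_zero]; rfl)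

/-- Otherwise some indecomposable summand `A` of the wild module would be isomorphic to a summand of
a semisimple module and hence be killed by `t₀ = T_0`. But on the wild module the kernel and the
image of `t₀` coincide. So an element `x` of `A` has the form `t₀ • w'`, and projecting `w'` to `A`
shows that `x = 0`. -/
theorem WildModule.homThrough_le_radHom (hn : 0 < n) :
    homThrough (semisimpleModules k n)
      (FGModuleCat.of (RadSquareZeroAlgebra k n) (WildModule n b c X))
      (FGModuleCat.of (RadSquareZeroAlgebra k n) (WildModule n b c Y)) ≤ radHom _ _ := by
  rintro _ ⟨Z, hZ, p, q, rfl⟩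
  let _ : Module k Z := Module.restrictScalars k (RadSquareZeroAlgebra k n) Z
  have : IsScalarTower k (RadSquareZeroAlgebra k n) Z :=
    IsScalarTower.restrictScalars k (RadSquareZeroAlgebra k n) Z
  have : FiniteDimensional k Z := Module.Finite.trans (RadSquareZeroAlgebra k n) Z
  refine comp_mem_radHom p q
    (id_mem_closure_indecomposableIdempotents (k := k) _ (WildModule n b c X) rfl)
    (id_mem_closure_indecomposableIdempotents (k := k) _ Z rfl) ?_
  intro A s p' A' t q' hA hA' hsp htq hiso
  have hs : ∀ x : A, p'.hom.hom (s.hom.hom x) = x := fun x =>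
    congrArg (fun h => h.hom.hom x) hsp
  have ht : ∀ x : A', q'.hom.hom (t.hom.hom x) = x := fun x =>
    congrArg (fun h => h.hom.hom x) htq
  let t₀ : RadSquareZeroAlgebra k n := T k (⟨0, hn⟩ : Fin n)
  have hA'0 : ∀ x : A', t₀ • x = 0 := by
    intro x
    rw [← ht x, ← map_smul, T_smul_eq_zero_of_addClosure hZ, map_zero]
  have hinj : ∀ x : A, (s ≫ p ≫ q').hom.hom x = 0 → x = 0 := by
    intro x hx
    have h1 := congrArg (fun h => h.hom.hom x) (IsIso.hom_inv_id (s ≫ p ≫ q'))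
    have h2 : (inv (s ≫ p ≫ q')).hom.hom ((s ≫ p ≫ q').hom.hom x) = x := h1
    rw [← h2, hx, map_zero]
  have hA0 : ∀ x : A, t₀ • x = 0 := fun x => hinj _ (by rw [map_smul, hA'0])
  have := hA.1
  obtain ⟨x, hx⟩ := exists_ne (0 : A)
  apply hx
  let w : WildModule n b c X := s.hom.hom x
  have hw : t₀ • w = 0 := by
    have := congrArg s.hom.hom (hA0 x)
    rw [map_smul, map_zero] at this
    exact this
  have hw1 : w.1 = 0 := by
    rw [WildModule.T_zero_smul] at hw
    exact congrArg Prod.snd hw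
  let w' : WildModule n b c X := ((w.2, 0) : (Fin (m + 1) → X) × (Fin (m + 1) → X))
  have hww' : w = t₀ • w' := by
    rw [WildModule.T_zero_smul]
    exact Prod.ext hw1 rfl
  have hx' : p'.hom.hom w = x := hs x
  rw [← hx', hww']
  exact (map_smul p'.hom.hom t₀ w').trans (hA0 _)

open ModuleCat in
/-- The functor `WildModule`. -/
noncomputable def wildFunctor (n : ℕ) [FiniteDimensional k B] (b : Fin m → B)
    (c : Fin (m + 1) → k) : FGModuleCat.{u} B ⥤ FGModuleCat.{u} (RadSquareZeroAlgebra k n) where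
  obj X :=
    have : FiniteDimensional k X := Module.Finite.trans B X
    FGModuleCat.of _ (WildModule n b c X)
  map {X Y} f :=
    have : FiniteDimensional k X := Module.Finite.trans B X
    have : FiniteDimensional k Y := Module.Finite.trans B Y
    FGModuleCat.ofHom (WildModule.map f.hom.hom)
  map_id _ := rfl
  map_comp _ _ := rfl

open ModuleCat in
theorem isControlledWild (hn : 3 ≤ n) [Infinite k] :
    IsControlledWild k (RadSquareZeroAlgebra k n) := by
  intro B _ _ _
  let m := Module.finrank k B
  let b : Fin m → B := Module.finBasis k B
  have hb : Submodule.span k (Set.range b) = ⊤ := (Module.finBasis k B).span_eq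
  let c : Fin (m + 1) → k := fun j => Infinite.natEmbedding k j
  have hc : Function.Injective c :=
    (Infinite.natEmbedding k).injective.comp Fin.val_injective
  let F := wildFunctor n b c
  have hfin : ∀ X : FGModuleCat.{u} B, FiniteDimensional k X := fun X => Module.Finite.trans B X
  have hF : ∀ {X Y : FGModuleCat.{u} B} (f : X ⟶ Y) (w : WildModule n b c X),
      (F.map f).hom.hom w = ((fun j => f.hom.hom (w.1 j), fun j => f.hom.hom (w.2 j)) :
        (Fin (m + 1) → Y) × (Fin (m + 1) → Y)) := fun f w => rfl
  have hadd : F.Additive := ⟨fun {X Y f g} => rfl⟩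
  -- The first component of `F f` is `f` in each coordinate. This gives both faithfulness and the
  -- trivial intersection of the image of `F` with the maps through semisimple modules.
  have hzero : ∀ {X Y : FGModuleCat.{u} B} (f : X ⟶ Y),
      (∀ w : WildModule n b c X, ((F.map f).hom.hom w : WildModule n b c Y).1 = 0) → f = 0 := by
    intro X Y f hf
    ext x
    let w : WildModule n b c X :=
      ((fun _ => x, 0) : (Fin (m + 1) → X) × (Fin (m + 1) → X))
    exact congrFun (hf w) 0
  refine ⟨F, hadd, ⟨fun {X Y} f r => ?_⟩, ⟨fun {X Y f g} hfg => ?_⟩, ?_, semisimpleModules k n,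
    fun X Y => ⟨WildModule.homThrough_le_radHom (by omega), ?_⟩⟩
  · ext (w : WildModule n b c X)
    let v : WildModule n b c Y := (F.map f).hom.hom w
    have h1 : (F.map (r • f)).hom.hom w = r • v := rfl
    have h2 : (r • F.map f).hom.hom w = algebraMap k (RadSquareZeroAlgebra k n) r • v := rfl
    exact h1.trans ((algebraMap_smul _ r v).symm.trans h2.symm)
  · refine sub_eq_zero.1 (hzero (f - g) fun w => ?_)
    rw [F.map_sub, hfg, sub_self]
    rfl
  · intro X Y Z f g hfg
    exact WildModule.exact_map hfg
  · constructor
    · rw [AddSubgroup.disjoint_def]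
      rintro _ ⟨f, rfl⟩ hf
      have := hzero f ((WildModule.mem_homThrough_iff (by omega) _).1 hf)
      rw [this, map_zero]
    · rw [codisjoint_iff, AddSubgroup.eq_top_iff']
      intro f
      obtain ⟨φ, hφ⟩ := WildModule.exists_map_sub hn hc hb f.hom.hom
      let φ' : X ⟶ Y := ⟨ModuleCat.ofHom φ⟩
      have hmem : f - F.map φ' ∈ homThrough (semisimpleModules k n) (F.obj X) (F.obj Y) :=
        (WildModule.mem_homThrough_iff (by omega) _).2 hφ
      rw [← add_sub_cancel (F.map φ') f]
      exact AddSubgroup.add_mem_sup ⟨φ', rfl⟩ hmem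

end ControlledWild

end RadSquareZeroAlgebra

theorem proposition2 (k : Type u) [Field k] [IsAlgClosed k] (n : ℕ) (hn : 3 ≤ n) :
    -- the algebra is finite-dimensional, local, radical square zero and controlled wild
    (FiniteDimensional k (RadSquareZeroAlgebra k n) ∧
      IsLocalRing (RadSquareZeroAlgebra k n) ∧
      Ring.jacobson (RadSquareZeroAlgebra k n) ^ 2 = ⊥ ∧
      IsControlledWild k (RadSquareZeroAlgebra k n)) ∧
    -- its quiver Grassmannians are connected and rationally connected
    (∀ (M : Type u) [AddCommGroup M] [Module k M] [Module (RadSquareZeroAlgebra k n) M]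
        [IsScalarTower k (RadSquareZeroAlgebra k n) M] [FiniteDimensional k M] (i : ℕ),
      (i ≤ Module.finrank k M →
        ConnectedSpace (QuiverGrassmannian k (RadSquareZeroAlgebra k n) M i)) ∧
      IsRationallyChainConnected (QuiverGrassmannian.plucker
        (k := k) (A := RadSquareZeroAlgebra k n) (M := M) (i := i)) ∧
      (i ≤ Module.finrank k (moduleSocle (RadSquareZeroAlgebra k n) M) →
        ∀ U : QuiverGrassmannian k (RadSquareZeroAlgebra k n) M i,
          ¬ U.toSubmodule ≤ moduleSocle (RadSquareZeroAlgebra k n) M →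
          ∃ (U' : QuiverGrassmannian k (RadSquareZeroAlgebra k n) M i)
            (L : Set (QuiverGrassmannian k (RadSquareZeroAlgebra k n) M i)),
            U'.toSubmodule ≤ moduleSocle (RadSquareZeroAlgebra k n) M ∧
            IsProjectiveLineIn QuiverGrassmannian.plucker L ∧ U ∈ L ∧ U' ∈ L) ∧
      (Module.finrank k (moduleSocle (RadSquareZeroAlgebra k n) M) < i →
        ∀ U : QuiverGrassmannian k (RadSquareZeroAlgebra k n) M i,
          ¬ Module.jacobson (RadSquareZeroAlgebra k n) M ≤ U.toSubmodule →
          ∃ (U' : QuiverGrassmannian k (RadSquareZeroAlgebra k n) M i)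
            (L : Set (QuiverGrassmannian k (RadSquareZeroAlgebra k n) M i)),
            Module.jacobson (RadSquareZeroAlgebra k n) M ≤ U'.toSubmodule ∧
            IsProjectiveLineIn QuiverGrassmannian.plucker L ∧ U ∈ L ∧ U' ∈ L)) ∧
    -- not every projective variety is one of its quiver Grassmannians
    (∃ (N : ℕ) (V : Set (ℙ k (Fin (N + 1) → k))), IsClosed V ∧ IsIrreducible V ∧
      ∀ (M : Type u) [AddCommGroup M] [Module k M] [Module (RadSquareZeroAlgebra k n) M]
        [IsScalarTower k (RadSquareZeroAlgebra k n) M] [FiniteDimensional k M] (i : ℕ),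
        ¬ ∃ e : QuiverGrassmannian k (RadSquareZeroAlgebra k n) M i ≃ V,
          IsVarietyIso QuiverGrassmannian.plucker (fun x : V => (x : ℙ k (Fin (N + 1) → k))) e) := by
  obtain ⟨m, hm, hmk⟩ := exists_fermat_exponent k
  refine ⟨⟨inferInstance, inferInstance, RadSquareZeroAlgebra.jacobson_sq k,
    RadSquareZeroAlgebra.isControlledWild hn⟩, ?_, 2, fermatCurve k m, isClosed_fermatCurve m,
    isIrreducible_fermatCurve hmk, ?_⟩
  · intro M _ _ _ _ _ i
    refine ⟨RadSquareZeroAlgebra.connectedSpace_quiverGrassmannian,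
      RadSquareZeroAlgebra.isRationallyChainConnected, fun hi U hU => ?_, fun hi U hU => ?_⟩
    · obtain ⟨U', f, hU', -, hf, hUf, hUf'⟩ := RadSquareZeroAlgebra.exists_line_socle hi U hU
      exact ⟨U', _, hU', hf, hUf, hUf'⟩
    · obtain ⟨U', f, hU', -, hf, hUf, hUf'⟩ := RadSquareZeroAlgebra.exists_line_jacobson hi U hU
      exact ⟨U', _, hU', hf, hUf, hUf'⟩
  · rintro M _ _ _ _ _ i ⟨e, he⟩
    exact RadSquareZeroAlgebra.isRationallyChainConnected.not_isVarietyIso_fermat hm hmk e he
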